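/- Let $M$ be a (Hausdorff) smooth $m$-dimensional manifold. On $T^{big}M=TM\oplus T^*M$ consider the neutral metric $g((X,\alpha),(Y,\beta))=\frac12(\alpha(Y)+\beta(X))$ and the Courant bracket $$[(X,\alpha),(Y,\beta)]=\bigl([X,Y],\,L_X\beta-L_Y\alpha+\tfrac12 d(\alpha(Y)-\beta(X))\bigr).$$ A big-isotropic structure on $M$ is a $g$-isotropic smooth vector subbundle $E\subseteq T^{big}M$ of some constant rank $k$, $0\le k\le m$; $E'=E^{\perp_g}$ denotes its $g$-orthogonal bundle, and $E$ is integrable if the space $\Gamma E$ of its smooth sections is closed under the Courant bracket. Let $\mathcal F$ be a smooth foliation of $M$ by $p$-dimensional leaves. A local space of leaves is an open set $U\subseteq M$ such that the leaf space $Q_U=U/(\mathcal F|_U)$ is a (Hausdorff, $(m-p)$-dimensional) quotient manifold, i.e. the natural projection $\pi:U\to Q_U$ is a smooth submersion. If $A$ is a subbundle of $T^{big}M$, a projected bundle of $A$ on $Q_U$ is a smooth subbundle $\Delta_U\subseteq T^{big}Q_U$ such that $A|_U=\pi^*(\Delta_U)$, that is, for all $x\in U$, $$A_x=\{(X,\pi^*\alpha)\mid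 X\in T_xM,\ (\pi_*X,\alpha)\in(\Delta_U)_{\pi(x)}\}.$$ The subbundle $A$ is projectable if every point of $M$ lies in some local space of leaves $U$ on which $A$ has a projected bundle. **Proposition 5.5.** Let $E$ be a projectable big-isotropic structure on the foliated manifold $(M,\mathcal F)$. Then: 1. The orthogonal bundle $E'$ is a projectable smooth subbundle of $T^{big}M$. 2. For every local space of leaves $U$ and every projected bundle $\Delta_U$ of $E$ on $Q_U$, $\Delta_U$ is a big-isotropic structure on $Q_U$, and its orthogonal bundle $\Delta_U'$ is the unique projected bundle of $E'$ on $Q_U$. 3. $E$ is integrable if and only if all the local projected bundles $\Delta_U$ of $E$ are integrable. Moreover, for any family of local spaces of leaves $U$ that covers $M$, with projected bundles $\Delta_U$ of $E$, $E$ is integrable if and only if all the $\Delta_U$ of this family are integrable. -/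

import Mathlib

open Set Bundle
open scoped Manifold ContDiff Topology

universe u

noncomputable section

namespace BigIso

/-- The fibre at `x` of the big tangent bundle `TM ⊕ T*M` of an `m`-dimensional manifold. -/
abbrev BigTangent (m : ℕ) {M : Type u} [TopologicalSpace M]
    [ChartedSpace (EuclideanSpace ℝ (Fin m)) M] (x : M) : Type :=
  TangentSpace (𝓡 m) x × (TangentSpace (𝓡 m) x →L[ℝ] ℝ)

/-- A (not necessarily smooth) section of the big tangent bundle: a pair consisting of a vector
field and a `1`-form. -/
abbrev BigField (m : ℕ) (M : Type u) [TopologicalSpace M]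
    [ChartedSpace (EuclideanSpace ℝ (Fin m)) M] : Type u :=
  (x : M) → BigTangent m x

/-- A field of linear subspaces of the fibres of the big tangent bundle. -/
abbrev BigDistribution (m : ℕ) (M : Type u) [TopologicalSpace M]
    [ChartedSpace (EuclideanSpace ℝ (Fin m)) M] : Type u :=
  (x : M) → Submodule ℝ (BigTangent m x)

section Bundles

variable {m : ℕ} {M : Type u} [TopologicalSpace M]
  [ChartedSpace (EuclideanSpace ℝ (Fin m)) M]

/-- The vector field and the `1`-form of `σ` are both of class `C^∞` on `W`, as sections of the
tangent bundle and of the cotangent bundle. -/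
def SmoothOn [IsManifold (𝓡 m) ∞ M] (σ : BigField m M) (W : Set M) : Prop :=
  ContMDiffOn (𝓡 m) (𝓡 m).tangent ∞
    (fun x => (TotalSpace.mk' (EuclideanSpace ℝ (Fin m)) x (σ x).1 : TangentBundle (𝓡 m) M)) W ∧
  ContMDiffOn (𝓡 m) ((𝓡 m).prod 𝓘(ℝ, EuclideanSpace ℝ (Fin m) →L[ℝ] ℝ)) ∞
    (fun x => TotalSpace.mk' (EuclideanSpace ℝ (Fin m) →L[ℝ] ℝ)
      (E := fun y : M => TangentSpace (𝓡 m) y →L[ℝ] Bundle.Trivial M ℝ y) x (σ x).2) W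

/-- `E` is a smooth vector subbundle of rank `k` of the big tangent bundle: near each point it is
spanned by `k` pointwise linearly independent smooth sections. -/
def IsSubbundleOfRank [IsManifold (𝓡 m) ∞ M] (k : ℕ) (E : BigDistribution m M) : Prop :=
  ∀ x : M, ∃ W : Set M, IsOpen W ∧ x ∈ W ∧ ∃ s : Fin k → BigField m M,
    (∀ i, SmoothOn (s i) W) ∧
    ∀ y ∈ W, LinearIndependent ℝ (fun i => s i y) ∧
      Submodule.span ℝ (Set.range fun i => s i y) = E y

/-- `E` is a smooth vector subbundle (of some constant rank) of the big tangent bundle. -/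
def IsSubbundle [IsManifold (𝓡 m) ∞ M] (E : BigDistribution m M) : Prop :=
  ∃ k : ℕ, IsSubbundleOfRank k E

/-- The neutral metric `g((X,α),(Y,β)) = (α(Y) + β(X)) / 2`. -/
def neutralMetric {x : M} (v w : BigTangent m x) : ℝ :=
  (1 / 2 : ℝ) * (v.2 w.1 + w.2 v.1)

/-- The `g`-orthogonal `E'` of `E`. -/
def orth (E : BigDistribution m M) : BigDistribution m M := fun x =>
  { carrier := {v | ∀ w ∈ E x, neutralMetric v w = 0}
    zero_mem' := by
      intro w _
      simp [neutralMetric]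
    add_mem' := by
      intro a b ha hb w hw
      have h1 := ha w hw
      have h2 := hb w hw
      simp only [neutralMetric, Prod.snd_add, Prod.fst_add, map_add,
        add_apply] at h1 h2 ⊢
      linarith
    smul_mem' := by
      intro c a ha w hw
      have h1 := ha w hw
      simp only [neutralMetric, Prod.smul_snd, Prod.smul_fst, map_smul,
        smul_apply, smul_eq_mul] at h1 ⊢
      linear_combination c * h1 }

/-- A big-isotropic structure: a `g`-isotropic smooth subbundle of rank `k`, `0 ≤ k ≤ m`. -/
def IsBigIsotropic [IsManifold (𝓡 m) ∞ M] (E : BigDistribution m M) : Prop :=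
  (∃ k ≤ m, IsSubbundleOfRank k E) ∧ ∀ x, ∀ v ∈ E x, ∀ w ∈ E x, neutralMetric v w = 0

/-- The Lie derivative `L_X β` of a `1`-form along a vector field on a vector space:
`(L_X β)_i = X^j ∂_j β_i + β_j ∂_i X^j`. -/
def lieDerivVec {V : Type*} [NormedAddCommGroup V] [NormedSpace ℝ V]
    (X : V → V) (β : V → (V →L[ℝ] ℝ)) (y : V) : V →L[ℝ] ℝ :=
  fderiv ℝ β y (X y) + (β y).comp (fderiv ℝ X y)

/-- The Lie derivative `L_X β` of a `1`-form `β` along a vector field `X` on a manifold, computed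
in the preferred chart at `x` (as for Mathlib's bracket of vector fields
`VectorField.mlieBracket`). -/
def lieDeriv (X : (x : M) → TangentSpace (𝓡 m) x)
    (β : (x : M) → (TangentSpace (𝓡 m) x →L[ℝ] ℝ)) (x : M) : TangentSpace (𝓡 m) x →L[ℝ] ℝ :=
  (lieDerivVec (V := EuclideanSpace ℝ (Fin m))
    (VectorField.mpullback 𝓘(ℝ, EuclideanSpace ℝ (Fin m)) (𝓡 m) (extChartAt (𝓡 m) x).symm X)
    (fun y => (β ((extChartAt (𝓡 m) x).symm y)).comp
      (mfderiv 𝓘(ℝ, EuclideanSpace ℝ (Fin m)) (𝓡 m) (extChartAt (𝓡 m) x).symm y))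
    (extChartAt (𝓡 m) x x)).comp
  (mfderiv (𝓡 m) 𝓘(ℝ, EuclideanSpace ℝ (Fin m)) (extChartAt (𝓡 m) x) x)

/-- The differential of a real function, as a covector. -/
def dFun (f : M → ℝ) (x : M) : TangentSpace (𝓡 m) x →L[ℝ] ℝ :=
  mfderiv (𝓡 m) 𝓘(ℝ, ℝ) f x

/-- The Courant bracket
`[(X,α),(Y,β)] = ([X,Y], L_X β - L_Y α + (1/2) d(α(Y) - β(X)))`. -/
def courant (σ τ : BigField m M) : BigField m M := fun x =>
  (VectorField.mlieBracket (𝓡 m) (fun y => (σ y).1) (fun y => (τ y).1) x,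
    lieDeriv (fun y => (σ y).1) (fun y => (τ y).2) x
      - lieDeriv (fun y => (τ y).1) (fun y => (σ y).2) x
      + (1 / 2 : ℝ) • dFun (fun y => (σ y).2 (τ y).1 - (τ y).2 (σ y).1) x)

/-- `σ ∈ ΓE`: `σ` is a smooth global section of `E`. -/
def IsSection [IsManifold (𝓡 m) ∞ M] (E : BigDistribution m M) (σ : BigField m M) : Prop :=
  SmoothOn σ Set.univ ∧ ∀ x, σ x ∈ E x

/-- `ΓE` is closed under the Courant bracket. (The bracket of smooth sections of the big tangent
bundle is smooth in any case, so that only the values of the bracket have to be tested.) -/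
def IsIntegrable [IsManifold (𝓡 m) ∞ M] (E : BigDistribution m M) : Prop :=
  ∀ σ τ : BigField m M, IsSection E σ → IsSection E τ → ∀ x, courant σ τ x ∈ E x

/-- The pullback of a field of subspaces `D` by a map `f : M → N` at `x`: the subspace
`{(X, f^*α) | X ∈ T_x M, (f_* X, α) ∈ D_{f x}}`. -/
def bigPullback {n : ℕ} {N : Type u} [TopologicalSpace N]
    [ChartedSpace (EuclideanSpace ℝ (Fin n)) N] (f : M → N) (D : BigDistribution n N) :
    BigDistribution m M := fun x =>
  { carrier := {v | ∃ α : TangentSpace (𝓡 n) (f x) →L[ℝ] ℝ,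
      (mfderiv (𝓡 m) (𝓡 n) f x v.1, α) ∈ D (f x) ∧
        v.2 = α.comp (mfderiv (𝓡 m) (𝓡 n) f x)}
    zero_mem' := by
      refine ⟨0, ?_, ?_⟩
      · rw [Prod.fst_zero, map_zero]; exact (D (f x)).zero_mem
      · ext; simp
    add_mem' := by
      rintro a b ⟨α, h1, h2⟩ ⟨β, h3, h4⟩
      refine ⟨α + β, ?_, ?_⟩
      · simpa using (D (f x)).add_mem h1 h3
      · ext; simp [h2, h4]
    smul_mem' := by
      rintro c a ⟨α, h1, h2⟩
      refine ⟨c • α, ?_, ?_⟩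
      · simpa using (D (f x)).smul_mem c h1
      · ext; simp [h2] }

end Bundles

/-- A smooth foliation of an `m`-dimensional manifold by `p`-dimensional leaves, given by the
tangent spaces of its leaves: around each point there is a chart of the smooth structure with
coordinates `(z¹,…,zᵖ,y¹,…,y^(m-p))` in which the foliation has the equations `dyᵘ = 0`. -/
structure Foliation (m p : ℕ) (M : Type u) [TopologicalSpace M]
    [ChartedSpace (EuclideanSpace ℝ (Fin m)) M] where
  /-- the tangent space of the leaf through `x` -/
  tangent : (x : M) → Submodule ℝ (TangentSpace (𝓡 m) x)
  /-- the dimension of the leaves is at most that of the manifold -/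
  dim_le : p ≤ m
  /-- existence of adapted charts -/
  exists_adapted : ∀ x : M, ∃ e ∈ IsManifold.maximalAtlas (𝓡 m) ∞ M, x ∈ e.source ∧
    ∀ y ∈ e.source, ∀ v : TangentSpace (𝓡 m) y, v ∈ tangent y ↔
      ∀ i : Fin m, p ≤ (i : ℕ) →
        (EuclideanSpace.proj i : EuclideanSpace ℝ (Fin m) →L[ℝ] ℝ)
          (mfderiv (𝓡 m) 𝓘(ℝ, EuclideanSpace ℝ (Fin m)) e y v) = 0

section Foliated

variable {m p : ℕ} {M : Type u} [TopologicalSpace M]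
  [ChartedSpace (EuclideanSpace ℝ (Fin m)) M]

/-- `x` and `y` are joined by a smooth curve in `U` that is everywhere tangent to the foliation. -/
def JoinedByLeafCurve (F : Foliation m p M) (U : Set M) (x y : M) : Prop :=
  ∃ γ : ℝ → M, ContMDiff 𝓘(ℝ, ℝ) (𝓡 m) ∞ γ ∧ γ 0 = x ∧ γ 1 = y ∧
    ∀ t : ℝ, γ t ∈ U ∧ mfderiv 𝓘(ℝ, ℝ) (𝓡 m) γ t (1 : ℝ) ∈ F.tangent (γ t)

/-- For points `x`, `y` of `U`: `x` and `y` lie on the same leaf of the restricted foliation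
`F|_U`, that is, they are joined by a finite chain of leaf curves in `U`. -/
def SameLeaf (F : Foliation m p M) (U : Set M) : M → M → Prop :=
  Relation.EqvGen (JoinedByLeafCurve F U)

/-- A local space of leaves: an open set `U` of `M` together with a quotient manifold
`Q = U / (F|_U)`. The manifold `Q` is Hausdorff of dimension `m - p`, and `π : U → Q` is
a surjective submersion whose fibres are the leaves of `F|_U`; this determines `Q` up to a unique
diffeomorphism. The projection is recorded as a function on `M`, of which only the values on `U`
matter. -/
structure LocalLeafSpace (F : Foliation m p M) : Type (u + 1) where
  /-- the open set `U` -/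
  U : Set M
  isOpen_U : IsOpen U
  /-- the quotient manifold -/
  Q : Type u
  [topQ : TopologicalSpace Q]
  [chartedQ : ChartedSpace (EuclideanSpace ℝ (Fin (m - p))) Q]
  [manifoldQ : IsManifold (𝓡 (m - p)) ∞ Q]
  [t2Q : T2Space Q]
  /-- the projection `π : U → Q` -/
  proj : M → Q
  smooth_proj : ContMDiffOn (𝓡 m) (𝓡 (m - p)) ∞ proj U
  submersion_proj : ∀ x ∈ U, Function.Surjective (mfderiv (𝓡 m) (𝓡 (m - p)) proj x)
  surj_proj : ∀ q : Q, ∃ x ∈ U, proj x = q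
  fiber_proj : ∀ x ∈ U, ∀ y ∈ U, proj x = proj y ↔ SameLeaf F U x y

attribute [instance] LocalLeafSpace.topQ LocalLeafSpace.chartedQ LocalLeafSpace.manifoldQ
  LocalLeafSpace.t2Q

/-- `D` is a projected bundle of `E` on the local space of leaves `L`: it is a subbundle of the
big tangent bundle of `L.Q` with `E|_U = π^*(D)`. -/
def IsProjectedBundle {F : Foliation m p M} (L : LocalLeafSpace F) (E : BigDistribution m M)
    (D : BigDistribution (m - p) L.Q) : Prop :=
  IsSubbundle D ∧ ∀ x ∈ L.U, E x = bigPullback L.proj D x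

/-- `E` is a projectable (foliated) subbundle of the big tangent bundle. -/
def IsProjectable [IsManifold (𝓡 m) ∞ M] (F : Foliation m p M) (E : BigDistribution m M) : Prop :=
  IsSubbundle E ∧ ∀ x : M, ∃ L : LocalLeafSpace F, x ∈ L.U ∧
    ∃ D : BigDistribution (m - p) L.Q, IsProjectedBundle L E D

/-- A local projected structure of `E`: a local space of leaves with a projected bundle of `E`. -/
structure LocalProjection (F : Foliation m p M) (E : BigDistribution m M) : Type (u + 1) where
  /-- the local space of leaves -/
  L : LocalLeafSpace F
  /-- the projected bundle on it -/
  D : BigDistribution (m - p) L.Q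
  isProjected : IsProjectedBundle L E D

end Foliated

end BigIso

end

/-! The first two assertions are pointwise linear algebra. For a surjective linear map `A : V → W`,
pulling subspaces of `W ⊕ W*` back to `V ⊕ V*` is injective and commutes with orthogonals
(`pull_injective`, `orthogonal_pull`): the pullback contains `ker A ⊕ 0`, so a covector part
orthogonal to it descends to `W`, and lifts pair as the elements they lift. Applied to the
differential of the projection at each point, this yields the projected bundle of the orthogonal,
its uniqueness, and isotropy downstairs. Smoothness of the orthogonal bundle is
`HasLocalFrame.orthogonal`.

Integrability is a condition on germs: bump functions extend local sections to global ones, so it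
amounts to closure under the bracket at every point (`isIntegrable_iff`). For an isotropic
subbundle, whether the bracket of two sections lies in it at `y` depends only on their values at `y`
(`courantVec_mem_of_eq`). Indeed, if one section vanishes at `y`, isotropy reduces the bracket to a
derivative of that section, which again lies in the subbundle.

A submersion lifts each local section of the projected bundle to a related section of the pullback,
with any admissible vector value at one point (`IsLocalSection.exists_lift`), and the bracket
respects related sections (`IsRelatedAt.courantVec`). Every value of the pullback is attained by
such lifts, so closure at `x` is equivalent to closure at the image of `x`
(`isClosedAt_iff_of_eventually_eq_pull`). Surjectivity of the projections and the covering property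
then give the third assertion. -/

noncomputable section

namespace BigIso

open Module Filter

/-! ### Linear algebra of `V ⊕ V*`: the pairing, and pullback along a surjection. -/

section LinearAlgebra

variable {V W : Type*} [NormedAddCommGroup V] [NormedSpace ℝ V]
  [NormedAddCommGroup W] [NormedSpace ℝ W]

/-- The big space `V ⊕ V*` of a normed space `V`. -/
abbrev Big (V : Type*) [NormedAddCommGroup V] [NormedSpace ℝ V] : Type _ := V × (V →L[ℝ] ℝ)

/-- The functional `w ↦ w.2 v.1 + v.2 w.1` on the big space. -/
def flatBig (v : Big V) : Big V →L[ℝ] ℝ :=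
  v.2 ∘L ContinuousLinearMap.fst ℝ V (V →L[ℝ] ℝ) +
    ((ContinuousLinearMap.id ℝ (V →L[ℝ] ℝ)).flip v.1) ∘L ContinuousLinearMap.snd ℝ V (V →L[ℝ] ℝ)

@[simp] theorem flatBig_apply (v w : Big V) : flatBig v w = v.2 w.1 + w.2 v.1 := by
  simp [flatBig]

/-- The canonical symmetric pairing (twice the neutral metric) of the big space. -/
def pairing (V : Type*) [NormedAddCommGroup V] [NormedSpace ℝ V] :
    LinearMap.BilinForm ℝ (Big V) :=
  LinearMap.mk₂ ℝ (fun v w => flatBig v w)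
    (by intro a b c; simp; ring) (by intro a b c; simp; ring)
    (by intro a b c; simp; ring) (by intro a b c; simp)

@[simp] theorem pairing_apply (v w : Big V) : pairing V v w = v.2 w.1 + w.2 v.1 := by
  simp [pairing]

theorem pairing_comm (v w : Big V) : pairing V v w = pairing V w v := by
  simp [add_comm]

theorem pairing_isRefl : (pairing V).IsRefl := by
  intro v w h
  rw [pairing_comm]; exact h

/-- A norming functional (Hahn–Banach) detects the vector part, and the elements `(x, 0)` detect the
covector part. -/
theorem pairing_nondegenerate [FiniteDimensional ℝ V] : (pairing V).Nondegenerate := by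
  refine (LinearMap.IsRefl.nondegenerate_iff_separatingLeft (pairing_isRefl (V := V))).2 ?_
  intro v hv
  refine Prod.ext ?_ ?_
  · by_contra h
    obtain ⟨g, -, hg⟩ := exists_dual_vector ℝ v.1 (norm_ne_zero_iff.2 h)
    have := hv (0, g)
    simp only [pairing_apply, map_zero, zero_add, hg] at this
    exact h (norm_eq_zero.1 (by exact_mod_cast this))
  · ext x
    simpa using hv (x, 0)

theorem contDiffAt_flatBig {E : Type*} [NormedAddCommGroup E] [NormedSpace ℝ E] {s : E → Big V}
    {y : E} {n : WithTop ℕ∞} (hs : ContDiffAt ℝ n s y) : ContDiffAt ℝ n (fun z => flatBig (s z)) y := by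
  unfold flatBig
  have h1 : ContDiffAt ℝ n (fun z => (s z).1) y := hs.fst
  have h2 : ContDiffAt ℝ n (fun z => (s z).2) y := hs.snd
  have h3 : ContDiffAt ℝ n (fun z => (ContinuousLinearMap.id ℝ (V →L[ℝ] ℝ)).flip (s z).1) y := by
    fun_prop
  exact (h2.clm_comp contDiffAt_const).add (h3.clm_comp contDiffAt_const)

theorem mem_orthogonal_pairing {S : Submodule ℝ (Big V)} {v : Big V} :
    v ∈ (pairing V).orthogonal S ↔ ∀ w ∈ S, v.2 w.1 + w.2 v.1 = 0 := by
  rw [LinearMap.BilinForm.mem_orthogonal_iff]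
  refine forall₂_congr fun w _ => ?_
  rw [pairing_apply, add_comm]

theorem finrank_big [FiniteDimensional ℝ V] : finrank ℝ (Big V) = 2 * finrank ℝ V := by
  rw [finrank_prod, LinearEquiv.finrank_eq (LinearMap.toContinuousLinearMap (𝕜 := ℝ) (E := V)
    (F' := ℝ)).symm, Subspace.dual_finrank_eq]
  ring

/-- The orthogonal has dimension `2 dim V - dim S` and contains `S`. This supplies the rank bound
for projected bundles. -/
theorem finrank_le_of_isotropic [FiniteDimensional ℝ V] {S : Submodule ℝ (Big V)}
    (h : S ≤ (pairing V).orthogonal S) : finrank ℝ S ≤ finrank ℝ V := by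
  have h1 := Submodule.finrank_mono h
  rw [LinearMap.BilinForm.finrank_orthogonal pairing_nondegenerate, finrank_big] at h1
  have h2 := Submodule.finrank_le S
  omega

/-- The pullback of a subspace of the big space by a linear map. -/
def pull (A : V →L[ℝ] W) (S : Submodule ℝ (Big W)) : Submodule ℝ (Big V) where
  carrier := {v | ∃ α : W →L[ℝ] ℝ, (A v.1, α) ∈ S ∧ v.2 = α.comp A}
  zero_mem' := ⟨0, by rw [Prod.fst_zero, map_zero]; exact S.zero_mem, by ext; simp⟩
  add_mem' := by
    rintro a b ⟨α, h1, h2⟩ ⟨β, h3, h4⟩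
    exact ⟨α + β, by simpa using S.add_mem h1 h3, by ext; simp [h2, h4]⟩
  smul_mem' := by
    rintro c a ⟨α, h1, h2⟩
    exact ⟨c • α, by simpa using S.smul_mem c h1, by ext; simp [h2]⟩

theorem mem_pull {A : V →L[ℝ] W} {S : Submodule ℝ (Big W)} {v : Big V} :
    v ∈ pull A S ↔ ∃ α : W →L[ℝ] ℝ, (A v.1, α) ∈ S ∧ v.2 = α.comp A := Iff.rfl

theorem comp_left_injective {A : V →L[ℝ] W} (hA : Function.Surjective A) {α β : W →L[ℝ] ℝ}
    (h : α.comp A = β.comp A) : α = β := by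
  ext w
  obtain ⟨v, rfl⟩ := hA w
  exact congrArg (fun f : V →L[ℝ] ℝ => f v) h

theorem mk_comp_mem_pull {A : V →L[ℝ] W} (hA : Function.Surjective A) {S : Submodule ℝ (Big W)}
    {x : V} {α : W →L[ℝ] ℝ} : (x, α.comp A) ∈ pull A S ↔ (A x, α) ∈ S := by
  refine ⟨?_, fun h => ⟨α, h, rfl⟩⟩
  rintro ⟨β, h1, h2⟩
  rwa [comp_left_injective hA h2]

/-- Each element of `Big W` is `(A v, α)`, and its membership is read off from that of `(v, α ∘ A)`
in the pullback. This is the source of the uniqueness of projected bundles. -/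
theorem pull_injective {A : V →L[ℝ] W} (hA : Function.Surjective A) :
    Function.Injective (pull A) := by
  intro S T h
  ext ⟨w, α⟩
  obtain ⟨v, rfl⟩ := hA w
  rw [← mk_comp_mem_pull hA, h, mk_comp_mem_pull hA]

theorem exists_comp_eq_of_ker_le [FiniteDimensional ℝ W] {A : V →L[ℝ] W}
    (hA : Function.Surjective A) {ξ : V →L[ℝ] ℝ} (h : ∀ v, A v = 0 → ξ v = 0) :
    ∃ α : W →L[ℝ] ℝ, ξ = α.comp A := by
  obtain ⟨R, hR⟩ := (A : V →ₗ[ℝ] W).exists_rightInverse_of_surjective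
    (LinearMap.range_eq_top.2 hA)
  refine ⟨(LinearMap.toContinuousLinearMap ((ξ : V →ₗ[ℝ] ℝ) ∘ₗ R)), ?_⟩
  ext v
  have h1 : A (R (A v)) = A v := congrArg (fun f : W →ₗ[ℝ] W => f (A v)) hR
  -- `v - R (A v)` lies in the kernel of `A`, so `ξ` factors as `(ξ ∘ R) ∘ A`.
  have h2 := h (v - R (A v)) (by rw [map_sub, h1, sub_self])
  rw [map_sub, sub_eq_zero] at h2
  simpa using h2

theorem orthogonal_pull [FiniteDimensional ℝ W] {A : V →L[ℝ] W} (hA : Function.Surjective A)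
    (S : Submodule ℝ (Big W)) :
    (pairing V).orthogonal (pull A S) = pull A ((pairing W).orthogonal S) := by
  ext ⟨x, ξ⟩
  rw [mem_orthogonal_pairing]
  constructor
  · intro h
    -- Pairing with the elements `(v, 0)`, `v ∈ ker A`, of the pullback shows that `ξ` vanishes on
    -- the kernel and hence descends.
    obtain ⟨α, rfl⟩ := exists_comp_eq_of_ker_le (ξ := ξ) hA fun v hv => by
      have := h (v, 0) ⟨0, by rw [hv]; exact S.zero_mem, by simp⟩
      simpa using this
    rw [mk_comp_mem_pull hA, mem_orthogonal_pairing]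
    rintro ⟨w, β⟩ hw
    obtain ⟨v, rfl⟩ := hA w
    exact h (v, β.comp A) ((mk_comp_mem_pull hA).2 hw)
  · rintro ⟨α, h1, h2⟩ w ⟨β, h3, h4⟩
    rw [mem_orthogonal_pairing] at h1
    have := h1 _ h3
    simp only at h2 this
    rw [h2, h4]
    exact this

theorem isotropic_of_pull {A : V →L[ℝ] W} (hA : Function.Surjective A) {S : Submodule ℝ (Big W)}
    (h : pull A S ≤ (pairing V).orthogonal (pull A S)) : S ≤ (pairing W).orthogonal S := by
  rintro ⟨w, α⟩ hw
  rw [mem_orthogonal_pairing]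
  rintro ⟨w', β⟩ hw'
  obtain ⟨v, rfl⟩ := hA w
  obtain ⟨v', rfl⟩ := hA w'
  exact mem_orthogonal_pairing.1 (h ((mk_comp_mem_pull hA).2 hw)) (v', β.comp A)
    ((mk_comp_mem_pull hA).2 hw')

end LinearAlgebra

/-! ### Smooth frames of fields of subspaces on a vector space, and of their orthogonals. -/

section LocalFrames

variable {V W : Type*} [NormedAddCommGroup V] [NormedSpace ℝ V] 

/-- Near `y`, the field of subspaces `D` is spanned by `k` independent smooth sections. -/
def HasLocalFrame (k : ℕ) (D : V → Submodule ℝ (Big V)) (y : V) : Prop :=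
  ∃ s : Fin k → V → Big V, ∀ᶠ z in 𝓝 y, (∀ i, ContDiffAt ℝ ∞ (s i) z) ∧
    LinearIndependent ℝ (fun i => s i z) ∧ Submodule.span ℝ (Set.range fun i => s i z) = D z

/-- `s` is a smooth section of `D` near `y`. -/
def IsLocalSection (D : V → Submodule ℝ (Big V)) (y : V) (s : V → Big V) : Prop :=
  ∀ᶠ z in 𝓝 y, ContDiffAt ℝ ∞ s z ∧ s z ∈ D z

theorem HasLocalFrame.congr {k : ℕ} {D D' : V → Submodule ℝ (Big V)} {y : V}
    (h : HasLocalFrame k D y) (hD : ∀ᶠ z in 𝓝 y, D z = D' z) : HasLocalFrame k D' y := by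
  obtain ⟨s, hs⟩ := h
  refine ⟨s, ?_⟩
  filter_upwards [hs, hD] with z hz hz'
  exact ⟨hz.1, hz.2.1, hz.2.2.trans hz'⟩

theorem HasLocalFrame.exists_section {k : ℕ} {D : V → Submodule ℝ (Big V)} {y : V}
    (h : HasLocalFrame k D y) {v : Big V} (hv : v ∈ D y) :
    ∃ s, IsLocalSection D y s ∧ s y = v := by
  obtain ⟨s, hs⟩ := h
  rw [← hs.self_of_nhds.2.2, Submodule.mem_span_range_iff_exists_fun] at hv
  obtain ⟨c, hc⟩ := hv
  -- The coefficients of `v` in the frame are kept constant.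
  refine ⟨fun z => ∑ i, c i • s i z, ?_, hc⟩
  filter_upwards [hs] with z hz
  refine ⟨ContDiffAt.sum fun i _ => (hz.1 i).const_smul (c i), ?_⟩
  rw [← hz.2.2]
  exact Submodule.sum_mem _ fun i _ => Submodule.smul_mem _ _ (Submodule.subset_span ⟨i, rfl⟩)

theorem ContinuousLinearMap.eventually_isInvertible {E F G : Type*} [NormedAddCommGroup E]
    [NormedSpace ℝ E] [NormedAddCommGroup F] [NormedSpace ℝ F] [CompleteSpace E]
    [TopologicalSpace G]
    {T : G → E →L[ℝ] F} {y : G} (hT : ContinuousAt T y) (h : (T y).IsInvertible) :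
    ∀ᶠ z in 𝓝 y, (T z).IsInvertible := by
  obtain ⟨e, he⟩ := h
  have := ContinuousLinearEquiv.nhds e
  rw [he] at this
  filter_upwards [hT this] with z hz
  exact hz

theorem contDiffAt_clm_of_apply {E F G : Type*} [NormedAddCommGroup E] [NormedSpace ℝ E]
    [FiniteDimensional ℝ E] [NormedAddCommGroup F] [NormedSpace ℝ F] [NormedAddCommGroup G]
    [NormedSpace ℝ G] {n : WithTop ℕ∞} {f : G → E →L[ℝ] F} {y : G}
    (h : ∀ v, ContDiffAt ℝ n (fun z => f z v) y) : ContDiffAt ℝ n f y := by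
  let d := finrank ℝ E
  have hd : d = finrank ℝ (Fin d → ℝ) := (finrank_fin_fun ℝ).symm
  let e₁ := ContinuousLinearEquiv.ofFinrankEq hd
  let e₂ := (e₁.arrowCongr (1 : F ≃L[ℝ] F)).trans (ContinuousLinearEquiv.piRing (Fin d))
  rw [← Function.id_comp f, ← e₂.symm_comp_self]
  exact e₂.symm.contDiff.contDiffAt.comp y (contDiffAt_pi.2 fun i => h _)

theorem exists_coordinates {E : Type*} [NormedAddCommGroup E] [NormedSpace ℝ E]
    [FiniteDimensional ℝ E] (N : Submodule ℝ E) {n : ℕ} (hN : finrank ℝ N = n) :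
    ∃ C : E →L[ℝ] (Fin n → ℝ), ∀ v ∈ N, C v = 0 → v = 0 := by
  obtain ⟨p, hp⟩ := N.subtype.exists_leftInverse_of_injective N.ker_subtype
  let b : N ≃ₗ[ℝ] (Fin n → ℝ) := LinearEquiv.ofFinrankEq _ _ (by rw [hN, finrank_fin_fun])
  refine ⟨LinearMap.toContinuousLinearMap (b.toLinearMap ∘ₗ p), fun v hv h => ?_⟩
  have h2 : b (p v) = 0 := h
  have h4 : p v = ⟨v, hv⟩ := congrArg (fun f : N →ₗ[ℝ] N => f ⟨v, hv⟩) hp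
  rw [h4, map_eq_zero_iff b b.injective] at h2
  exact congrArg Subtype.val h2

/-- The orthogonal is the kernel of the `k` equations `L z` given by the frame. Adjoining `n` fixed
coordinates `C` of the orthogonal at `y` makes a square system `T z`, invertible at `y` and hence
nearby. The solutions of `T z v = (0, e_j)` form the required frame. -/
theorem HasLocalFrame.orthogonal [FiniteDimensional ℝ V] {k : ℕ} {D : V → Submodule ℝ (Big V)} {y : V}
    (h : HasLocalFrame k D y) :
    HasLocalFrame (2 * finrank ℝ V - k) (fun z => (pairing V).orthogonal (D z)) y := by
  obtain ⟨s, hs⟩ := h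
  set n := 2 * finrank ℝ V - k with hn
  let L : V → Big V →L[ℝ] (Fin k → ℝ) := fun z => ContinuousLinearMap.pi fun i => flatBig (s i z)
  have hrank : ∀ z, LinearIndependent ℝ (fun i => s i z) →
      Submodule.span ℝ (Set.range fun i => s i z) = D z → finrank ℝ (D z) = k := by
    intro z h1 h2
    rw [← h2, finrank_span_eq_card h1, Fintype.card_fin]
  have hker : ∀ z, Submodule.span ℝ (Set.range fun i => s i z) = D z → ∀ v,
      v ∈ (pairing V).orthogonal (D z) ↔ L z v = 0 := by
    intro z hz v
    rw [← hz, LinearMap.BilinForm.mem_orthogonal_iff]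
    constructor
    · intro hv
      ext i
      exact hv _ (Submodule.subset_span ⟨i, rfl⟩)
    · intro hv w hw
      induction hw using Submodule.span_induction with
      | mem x hx =>
        obtain ⟨i, rfl⟩ := hx
        exact congrFun hv i
      | zero => simp
      | add a b _ _ ha hb =>
        change pairing V (a + b) v = 0
        rw [map_add, LinearMap.add_apply]
        exact (congrArg₂ _ ha hb).trans (add_zero 0)
      | smul c a _ ha =>
        change pairing V (c • a) v = 0
        rw [map_smul, LinearMap.smul_apply]
        exact (congrArg _ ha).trans (smul_zero c)
  have hfin : ∀ z, finrank ℝ (D z) = k → finrank ℝ ((pairing V).orthogonal (D z)) = n := by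
    intro z hz
    rw [LinearMap.BilinForm.finrank_orthogonal pairing_nondegenerate, finrank_big, hz]
  obtain ⟨-, hy1, hy2⟩ := hs.self_of_nhds
  -- The subtraction in `n` is truncated; this bound gives `k + n = 2 dim V`, so that `T` is square.
  have hk : k ≤ 2 * finrank ℝ V := by
    rw [← finrank_big, ← hrank y hy1 hy2]
    exact Submodule.finrank_le _
  obtain ⟨C, hC⟩ := exists_coordinates ((pairing V).orthogonal (D y)) (hfin y (hrank y hy1 hy2))
  let T : V → Big V →L[ℝ] (Fin k → ℝ) × (Fin n → ℝ) := fun z => (L z).prod C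
  have hTinj : Function.Injective (T y) := by
    rw [injective_iff_map_eq_zero]
    intro v hv
    have h1 : L y v = 0 := congrArg Prod.fst hv
    exact hC v ((hker y hy2 v).2 h1) (congrArg Prod.snd hv)
  have hTinv : (T y).IsInvertible := by
    refine ⟨(LinearEquiv.ofInjectiveOfFinrankEq (T y : Big V →ₗ[ℝ] _) hTinj ?_).toContinuousLinearEquiv,
      ?_⟩
    · rw [finrank_big, finrank_prod, finrank_fin_fun, finrank_fin_fun]
      omega
    · ext v <;> rfl
  have hTsmooth : ∀ z, (∀ i, ContDiffAt ℝ ∞ (s i) z) → ContDiffAt ℝ ∞ T z := by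
    intro z hz
    refine contDiffAt_clm_of_apply fun v => ?_
    refine ContDiffAt.prodMk ?_ contDiffAt_const
    refine contDiffAt_pi.2 fun i => ?_
    exact (contDiffAt_flatBig (hz i)).clm_apply contDiffAt_const
  have hinv := ContinuousLinearMap.eventually_isInvertible
    (hTsmooth y hs.self_of_nhds.1).continuousAt hTinv
  refine ⟨fun j z => (T z).inverse (0, Pi.single j 1), ?_⟩
  filter_upwards [hs, hinv] with z hz hz'
  have hTr : ∀ j, T z ((T z).inverse (0, Pi.single j 1)) = (0, Pi.single j 1) := by
    obtain ⟨e, he⟩ := hz'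
    intro j
    rw [← he]
    simp
  have hli : LinearIndependent ℝ fun j : Fin n => (T z).inverse ((0 : Fin k → ℝ), Pi.single j 1) := by
    -- `C` sends the candidate frame to the standard basis.
    refine LinearIndependent.of_comp (C : Big V →ₗ[ℝ] (Fin n → ℝ)) ?_
    convert! (Pi.basisFun ℝ (Fin n)).linearIndependent using 1
    ext j : 1
    rw [Pi.basisFun_apply]
    exact congrArg Prod.snd (hTr j)
  refine ⟨fun j => ?_, hli, ?_⟩
  · exact ((hz'.contDiffAt_map_inverse).comp z (hTsmooth z hz.1)).clm_apply contDiffAt_const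
  · refine Submodule.eq_of_le_of_finrank_eq ?_ ?_
    · rw [Submodule.span_le]
      rintro _ ⟨j, rfl⟩
      exact (hker z hz.2.2 _).2 (congrArg Prod.fst (hTr j))
    · rw [finrank_span_eq_card hli, Fintype.card_fin, hfin z (hrank z hz.2.1 hz.2.2)]

end LocalFrames

/-! ### The Courant bracket on a vector space and its naturality. -/

section BracketVec

variable {V W : Type*} [NormedAddCommGroup V] [NormedSpace ℝ V]
  [NormedAddCommGroup W] [NormedSpace ℝ W]

/-- The Courant bracket on a vector space. -/
def courantVec (s t : V → Big V) (y : V) : Big V :=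
  (VectorField.lieBracket ℝ (fun z => (s z).1) (fun z => (t z).1) y,
    lieDerivVec (fun z => (s z).1) (fun z => (t z).2) y
      - lieDerivVec (fun z => (t z).1) (fun z => (s z).2) y
      + (1 / 2 : ℝ) • fderiv ℝ (fun z => (s z).2 (t z).1 - (t z).2 (s z).1) y)

theorem courantVec_congr {s s' t t' : V → Big V} {y : V} (hs : s =ᶠ[𝓝 y] s') (ht : t =ᶠ[𝓝 y] t') :
    courantVec s t y = courantVec s' t' y := by
  have h1 : (fun z => (s z).1) =ᶠ[𝓝 y] fun z => (s' z).1 := hs.fun_comp Prod.fst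
  have h2 : (fun z => (s z).2) =ᶠ[𝓝 y] fun z => (s' z).2 := hs.fun_comp Prod.snd
  have h3 : (fun z => (t z).1) =ᶠ[𝓝 y] fun z => (t' z).1 := ht.fun_comp Prod.fst
  have h4 : (fun z => (t z).2) =ᶠ[𝓝 y] fun z => (t' z).2 := ht.fun_comp Prod.snd
  have h5 : (fun z => (s z).2 (t z).1 - (t z).2 (s z).1) =ᶠ[𝓝 y]
      fun z => (s' z).2 (t' z).1 - (t' z).2 (s' z).1 := by
    filter_upwards [hs, ht] with z hz hz'
    rw [hz, hz']
  unfold courantVec lieDerivVec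
  rw [h1.lieBracket_vectorField_eq h3, h1.fderiv_eq, h2.fderiv_eq, h3.fderiv_eq, h4.fderiv_eq,
    h5.fderiv_eq]
  simp only [hs.self_of_nhds, ht.self_of_nhds]

/-- Antisymmetry transfers statements about the left argument to the right one. -/
theorem courantVec_swap (s t : V → Big V) (y : V) : courantVec s t y = -courantVec t s y := by
  unfold courantVec
  refine Prod.ext ?_ ?_
  · simp only [Prod.fst_neg]
    exact VectorField.lieBracket_swap
  · have : (fun z => (s z).2 (t z).1 - (t z).2 (s z).1) =
        fun z => -((t z).2 (s z).1 - (s z).2 (t z).1) := by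
      ext z; ring
    simp only [Prod.snd_neg]
    rw [this, fderiv_fun_neg]
    module

section Derivatives

variable {s t : V → Big V} {y : V}

theorem fderiv_fst_comp {s : V → Big W} (hs : DifferentiableAt ℝ s y) (v : V) :
    fderiv ℝ (fun z => (s z).1) y v = (fderiv ℝ s y v).1 := by
  rw [fderiv.fst hs]; rfl

theorem fderiv_snd_comp {s : V → Big W} (hs : DifferentiableAt ℝ s y) (v : V) :
    fderiv ℝ (fun z => (s z).2) y v = (fderiv ℝ s y v).2 := by
  rw [fderiv.snd hs]; rfl

theorem fderiv_snd_apply_fst (hs : DifferentiableAt ℝ s y) (ht : DifferentiableAt ℝ t y) (v : V) :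
    fderiv ℝ (fun z => (s z).2 (t z).1) y v =
      (fderiv ℝ s y v).2 (t y).1 + (s y).2 (fderiv ℝ t y v).1 := by
  rw [fderiv_clm_apply hs.snd ht.fst]
  simp [fderiv_fst_comp ht, fderiv_snd_comp hs, add_comm]

theorem courantVec_fst (hs : DifferentiableAt ℝ s y) (ht : DifferentiableAt ℝ t y) :
    (courantVec s t y).1 = (fderiv ℝ t y (s y).1).1 - (fderiv ℝ s y (t y).1).1 := by
  rw [← fderiv_fst_comp hs, ← fderiv_fst_comp ht]; rfl

theorem courantVec_snd (hs : DifferentiableAt ℝ s y) (ht : DifferentiableAt ℝ t y) (v : V) :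
    (courantVec s t y).2 v = (fderiv ℝ t y (s y).1).2 v + (t y).2 (fderiv ℝ s y v).1
      - ((fderiv ℝ s y (t y).1).2 v + (s y).2 (fderiv ℝ t y v).1)
      + (1 / 2) * ((fderiv ℝ s y v).2 (t y).1 + (s y).2 (fderiv ℝ t y v).1
        - ((fderiv ℝ t y v).2 (s y).1 + (t y).2 (fderiv ℝ s y v).1)) := by
  have h1 : fderiv ℝ (fun z => (s z).2 (t z).1 - (t z).2 (s z).1) y v =
      (fderiv ℝ s y v).2 (t y).1 + (s y).2 (fderiv ℝ t y v).1
        - ((fderiv ℝ t y v).2 (s y).1 + (t y).2 (fderiv ℝ s y v).1) := by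
    rw [fderiv_fun_sub (hs.snd.clm_apply ht.fst) (ht.snd.clm_apply hs.fst), sub_apply,
      fderiv_snd_apply_fst hs ht, fderiv_snd_apply_fst ht hs]
  rw [← h1]
  simp only [courantVec, lieDerivVec, add_apply, sub_apply, smul_apply,
    ContinuousLinearMap.comp_apply, fderiv_fst_comp hs, fderiv_fst_comp ht, fderiv_snd_comp hs,
    fderiv_snd_comp ht, smul_eq_mul]

theorem courantVec_sub_left {s' : V → Big V} (hs : DifferentiableAt ℝ s y)
    (hs' : DifferentiableAt ℝ s' y) (ht : DifferentiableAt ℝ t y) :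
    courantVec (fun z => s z - s' z) t y = courantVec s t y - courantVec s' t y := by
  have h := hs.fun_sub hs'
  refine Prod.ext ?_ ?_
  · rw [Prod.fst_sub, courantVec_fst h ht, courantVec_fst hs ht, courantVec_fst hs' ht,
      fderiv_fun_sub hs hs']
    simp only [Prod.fst_sub, sub_apply, map_sub]
    abel
  · ext v
    rw [Prod.snd_sub, sub_apply, courantVec_snd h ht, courantVec_snd hs ht, courantVec_snd hs' ht,
      fderiv_fun_sub hs hs']
    simp only [Prod.fst_sub, Prod.snd_sub, sub_apply, map_sub]
    ring

/-- The bracket of two orthogonal sections, the first of which vanishes at the point. -/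
theorem courantVec_of_eq_zero (hs : DifferentiableAt ℝ s y) (ht : DifferentiableAt ℝ t y)
    (h0 : s y = 0) (hst : ∀ᶠ z in 𝓝 y, pairing V (s z) (t z) = 0) :
    courantVec s t y = -fderiv ℝ s y (t y).1 := by
  refine Prod.ext ?_ ?_
  · rw [courantVec_fst hs ht, h0]
    simp
  · ext v
    have h1 : (fun z => (s z).2 (t z).1 + (t z).2 (s z).1) =ᶠ[𝓝 y] fun _ => 0 := by
      filter_upwards [hst] with z hz
      rwa [pairing_apply] at hz
    -- Since `s y = 0`, the covector part of the bracket differs from the claimed value by half the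
    -- differential of the pairing of `s` and `t`, which vanishes near `y`.
    have h2 : fderiv ℝ (fun z => (s z).2 (t z).1 + (t z).2 (s z).1) y v = 0 := by
      rw [h1.fderiv_eq]; simp
    rw [fderiv_fun_add (hs.snd.clm_apply ht.fst) (ht.snd.clm_apply hs.fst), add_apply,
      fderiv_snd_apply_fst hs ht, fderiv_snd_apply_fst ht hs] at h2
    rw [courantVec_snd hs ht]
    simp only [h0, Prod.fst_zero, Prod.snd_zero, map_zero, zero_apply, zero_add, add_zero,
      Prod.snd_neg, neg_apply] at h2 ⊢
    linear_combination (1 / 2) * h2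

end Derivatives

section Related

variable {f : V → W} {y : V}

/-- The sections `s` and `s'` are related by the map `f` at `z`. -/
def IsRelatedAt (f : V → W) (s : V → Big V) (s' : W → Big W) (z : V) : Prop :=
  fderiv ℝ f z (s z).1 = (s' (f z)).1 ∧ (s z).2 = (s' (f z)).2.comp (fderiv ℝ f z)

/-- This is the relation of the vector parts, differentiated along `v`; the product rule produces
the second derivative of `f`. -/
theorem IsRelatedAt.fderiv_fst {s : V → Big V} {s' : W → Big W} (hf : ContDiffAt ℝ 2 f y)
    (hs : DifferentiableAt ℝ s y) (hs' : DifferentiableAt ℝ s' (f y))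
    (h : ∀ᶠ z in 𝓝 y, IsRelatedAt f s s' z) (v : V) :
    (fderiv ℝ s' (f y) (fderiv ℝ f y v)).1 =
      fderiv ℝ (fderiv ℝ f) y v (s y).1 + fderiv ℝ f y (fderiv ℝ s y v).1 := by
  have hf1 : DifferentiableAt ℝ f y := hf.differentiableAt two_ne_zero
  have hf2 : DifferentiableAt ℝ (fderiv ℝ f) y :=
    (hf.fderiv_right (m := 1) le_rfl).differentiableAt one_ne_zero
  have h1 : (fun z => fderiv ℝ f z (s z).1) =ᶠ[𝓝 y] fun z => (s' (f z)).1 := by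
    filter_upwards [h] with z hz using hz.1
  have h2 := congrArg (fun L : V →L[ℝ] W => L v) h1.fderiv_eq
  have h3 : fderiv ℝ (fun z => (s' (f z)).1) y v = (fderiv ℝ s' (f y) (fderiv ℝ f y v)).1 := by
    rw [fderiv_fst_comp (s := fun z => s' (f z)) (hs'.comp y hf1), fderiv_fun_comp y hs' hf1]
    rfl
  simp only [h3] at h2
  rw [← h2, fderiv_clm_apply hf2 hs.fst]
  simp [fderiv_fst_comp hs, add_comm]

/-- The same differentiation for the covector parts, evaluated on `w`. -/
theorem IsRelatedAt.fderiv_snd {s : V → Big V} {s' : W → Big W} (hf : ContDiffAt ℝ 2 f y)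
    (hs : DifferentiableAt ℝ s y) (hs' : DifferentiableAt ℝ s' (f y))
    (h : ∀ᶠ z in 𝓝 y, IsRelatedAt f s s' z) (v w : V) :
    (fderiv ℝ s y v).2 w = (fderiv ℝ s' (f y) (fderiv ℝ f y v)).2 (fderiv ℝ f y w) +
      (s' (f y)).2 (fderiv ℝ (fderiv ℝ f) y v w) := by
  have hf1 : DifferentiableAt ℝ f y := hf.differentiableAt two_ne_zero
  have hf2 : DifferentiableAt ℝ (fderiv ℝ f) y :=
    (hf.fderiv_right (m := 1) le_rfl).differentiableAt one_ne_zero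
  have hc : DifferentiableAt ℝ (fun z => s' (f z)) y := hs'.comp y hf1
  have h1 : (fun z => (s z).2) =ᶠ[𝓝 y] fun z => (s' (f z)).2.comp (fderiv ℝ f z) := by
    filter_upwards [h] with z hz using hz.2
  have h2 := congrArg (fun L : V →L[ℝ] V →L[ℝ] ℝ => L v w) h1.fderiv_eq
  simp only [fderiv_snd_comp hs] at h2
  rw [h2, fderiv_clm_comp hc.snd hf2]
  simp only [add_apply, ContinuousLinearMap.comp_apply, ContinuousLinearMap.flip_apply,
    ContinuousLinearMap.compL_apply, fderiv_snd_comp hc, fderiv_fun_comp y hs' hf1]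
  exact add_comm _ _

/-- The Courant bracket is natural with respect to related sections. -/
theorem IsRelatedAt.courantVec {s t : V → Big V} {s' t' : W → Big W} (hf : ContDiffAt ℝ 2 f y)
    (hs : DifferentiableAt ℝ s y) (hs' : DifferentiableAt ℝ s' (f y))
    (ht : DifferentiableAt ℝ t y) (ht' : DifferentiableAt ℝ t' (f y))
    (h : ∀ᶠ z in 𝓝 y, IsRelatedAt f s s' z) (h' : ∀ᶠ z in 𝓝 y, IsRelatedAt f t t' z) :
    IsRelatedAt f (courantVec s t) (courantVec s' t') y := by
  -- All second-derivative terms of `f` cancel in the bracket by this symmetry.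
  have hsymm : IsSymmSndFDerivAt ℝ f y := hf.isSymmSndFDerivAt (by simp)
  obtain ⟨hy1, hy2⟩ := h.self_of_nhds
  obtain ⟨hy1', hy2'⟩ := h'.self_of_nhds
  constructor
  · rw [courantVec_fst hs ht, courantVec_fst hs' ht', ← hy1, ← hy1',
      fderiv_fst hf hs hs' h, fderiv_fst hf ht ht' h', map_sub, hsymm (s y).1 (t y).1]
    abel
  · ext v
    rw [ContinuousLinearMap.comp_apply, courantVec_snd hs ht, courantVec_snd hs' ht', ← hy1,
      ← hy1', fderiv_fst hf hs hs' h, fderiv_fst hf ht ht' h', fderiv_snd hf hs hs' h,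
      fderiv_snd hf hs hs' h, fderiv_snd hf ht ht' h', fderiv_snd hf ht ht' h', hy2, hy2',
      hsymm v (s y).1, hsymm v (t y).1]
    simp only [ContinuousLinearMap.comp_apply, map_add]
    ring

end Related

end BracketVec

/-! ### Closure under the bracket at a point, and its invariance under submersions. -/

section Closed

variable {V W : Type*} [NormedAddCommGroup V] [NormedSpace ℝ V]
  [NormedAddCommGroup W] [NormedSpace ℝ W] {k l : ℕ} {y : V} {D : V → Submodule ℝ (Big V)}

/-- The value at `y` of the bracket of two smooth sections of `D` near `y` belongs to `D`. -/
def IsClosedAt (D : V → Submodule ℝ (Big V)) (y : V) : Prop :=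
  ∀ s t : V → Big V, IsLocalSection D y s → IsLocalSection D y t → courantVec s t y ∈ D y

/-- `D` is isotropic near `y`. -/
def IsIsotropicNear (D : V → Submodule ℝ (Big V)) (y : V) : Prop :=
  ∀ᶠ z in 𝓝 y, ∀ v ∈ D z, ∀ w ∈ D z, pairing V v w = 0

theorem IsLocalSection.differentiableAt {s : V → Big V} (hs : IsLocalSection D y s) :
    DifferentiableAt ℝ s y :=
  hs.self_of_nhds.1.differentiableAt (by simp)

theorem IsLocalSection.sub {s t : V → Big V} (hs : IsLocalSection D y s)
    (ht : IsLocalSection D y t) : IsLocalSection D y fun z => s z - t z := by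
  filter_upwards [hs, ht] with z hz hz'
  exact ⟨hz.1.sub hz'.1, (D z).sub_mem hz.2 hz'.2⟩

/-- The derivative of a section at one of its zeros takes values in the subbundle. -/
theorem IsLocalSection.fderiv_mem [FiniteDimensional ℝ V] (hD : HasLocalFrame k D y)
    {s : V → Big V} (hs : IsLocalSection D y s) (h0 : s y = 0) (v : V) : fderiv ℝ s y v ∈ D y := by
  -- Membership is tested against the orthogonal: each of its vectors at `y` extends to a local
  -- section `r`, and differentiating the zero pairing of `r` with `s` leaves only the pairing of `r
  -- y` with the derivative of `s`, because `s y = 0`.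
  rw [← LinearMap.BilinForm.orthogonal_orthogonal pairing_nondegenerate pairing_isRefl (D y),
    mem_orthogonal_pairing]
  intro w hw
  obtain ⟨r, hr, rfl⟩ := hD.orthogonal.exists_section hw
  have hs' := hs.differentiableAt
  have hr' := hr.differentiableAt
  have h1 : (fun z => (r z).2 (s z).1 + (s z).2 (r z).1) =ᶠ[𝓝 y] fun _ => 0 := by
    filter_upwards [hs, hr] with z hz hz'
    exact mem_orthogonal_pairing.1 hz'.2 _ hz.2
  have h2 : fderiv ℝ (fun z => (r z).2 (s z).1 + (s z).2 (r z).1) y v = 0 := by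
    rw [h1.fderiv_eq]; simp
  rw [fderiv_fun_add (hr'.snd.clm_apply hs'.fst) (hs'.snd.clm_apply hr'.fst), add_apply,
    fderiv_snd_apply_fst hs' hr', fderiv_snd_apply_fst hr' hs'] at h2
  simp only [h0, Prod.fst_zero, Prod.snd_zero, map_zero, zero_apply, zero_add, add_zero] at h2
  linarith

/-- Isotropy enters here: it makes `s` and `t` orthogonal near `y`, so the bracket is minus a
derivative of `s` at a zero, which lies in `D y`. -/
theorem courantVec_mem_of_eq_zero [FiniteDimensional ℝ V] (hD : HasLocalFrame k D y)
    (hiso : IsIsotropicNear D y) {s t : V → Big V} (hs : IsLocalSection D y s)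
    (ht : IsLocalSection D y t) (h0 : s y = 0) : courantVec s t y ∈ D y := by
  rw [courantVec_of_eq_zero hs.differentiableAt ht.differentiableAt h0]
  · exact (D y).neg_mem (hs.fderiv_mem hD h0 _)
  · filter_upwards [hs, ht, hiso] with z h1 h2 h3
    exact h3 _ h1.2 _ h2.2

theorem courantVec_mem_of_eq_left [FiniteDimensional ℝ V] (hD : HasLocalFrame k D y)
    (hiso : IsIsotropicNear D y) {s s' t : V → Big V} (hs : IsLocalSection D y s)
    (hs' : IsLocalSection D y s') (ht : IsLocalSection D y t) (h : s y = s' y)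
    (hmem : courantVec s t y ∈ D y) : courantVec s' t y ∈ D y := by
  have h1 := courantVec_mem_of_eq_zero hD hiso (hs.sub hs') ht (sub_eq_zero.2 h)
  rw [courantVec_sub_left hs.differentiableAt hs'.differentiableAt ht.differentiableAt] at h1
  simpa using (D y).sub_mem hmem h1

/-- Whether the bracket of two sections of an isotropic subbundle belongs to it at `y` only depends
on their values at `y`. -/
theorem courantVec_mem_of_eq [FiniteDimensional ℝ V] (hD : HasLocalFrame k D y)
    (hiso : IsIsotropicNear D y) {s s' t t' : V → Big V} (hs : IsLocalSection D y s)
    (hs' : IsLocalSection D y s') (ht : IsLocalSection D y t) (ht' : IsLocalSection D y t')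
    (h : s y = s' y) (h' : t y = t' y) (hmem : courantVec s t y ∈ D y) :
    courantVec s' t' y ∈ D y := by
  have h1 := courantVec_mem_of_eq_left hD hiso hs hs' ht h hmem
  rw [courantVec_swap, neg_mem_iff] at h1 ⊢
  exact courantVec_mem_of_eq_left hD hiso ht ht' hs' h' h1

theorem IsClosedAt.congr {D' : V → Submodule ℝ (Big V)} (h : IsClosedAt D y)
    (hD : ∀ᶠ z in 𝓝 y, D z = D' z) : IsClosedAt D' y := by
  intro s t hs ht
  rw [← hD.self_of_nhds]
  refine h s t ?_ ?_
  · filter_upwards [hs, hD] with z hz hz'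
    rwa [hz']
  · filter_upwards [ht, hD] with z hz hz'
    rwa [hz']

/-- Sections can be lifted along a submersion, with a prescribed value at one point. -/
theorem IsLocalSection.exists_lift [FiniteDimensional ℝ W] {f : V → W}
    {D : W → Submodule ℝ (Big W)} {s' : W → Big W}
    (hf : ∀ᶠ z in 𝓝 y, ContDiffAt ℝ ∞ f z) (hsurj : Function.Surjective (fderiv ℝ f y))
    (hs' : IsLocalSection D (f y) s') {x₀ : V} (hx₀ : fderiv ℝ f y x₀ = (s' (f y)).1) :
    ∃ s, IsLocalSection (fun z => pull (fderiv ℝ f z) (D (f z))) y s ∧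
      s y = (x₀, (s' (f y)).2.comp (fderiv ℝ f y)) ∧ ∀ᶠ z in 𝓝 y, IsRelatedAt f s s' z := by
  have : CompleteSpace W := FiniteDimensional.complete ℝ W
  -- A right inverse `R` at `y` gives `A z = df_z ∘ R`, which is the identity at `y` and so
  -- invertible nearby; `R ∘ (A z)⁻¹` is then a smooth family of right inverses of `df_z`.
  obtain ⟨R₀, hR₀⟩ := (fderiv ℝ f y : V →ₗ[ℝ] W).exists_rightInverse_of_surjective
    (LinearMap.range_eq_top.2 hsurj)
  let R : W →L[ℝ] V := LinearMap.toContinuousLinearMap R₀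
  let A : V → W →L[ℝ] W := fun z => (fderiv ℝ f z).comp R
  have hAy : A y = ContinuousLinearMap.id ℝ W := by
    ext w
    exact congrArg (fun g : W →ₗ[ℝ] W => g w) hR₀
  have hdf : ∀ z, ContDiffAt ℝ ∞ f z → ContDiffAt ℝ ∞ (fderiv ℝ f) z := fun z hz =>
    hz.fderiv_right (by simp)
  have hA : ∀ z, ContDiffAt ℝ ∞ f z → ContDiffAt ℝ ∞ A z := fun z hz =>
    (hdf z hz).clm_comp contDiffAt_const
  have hinv : ∀ᶠ z in 𝓝 y, (A z).IsInvertible :=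
    ContinuousLinearMap.eventually_isInvertible (hA y hf.self_of_nhds).continuousAt
      ⟨ContinuousLinearEquiv.refl ℝ W, by rw [hAy]; rfl⟩
  have hs'f : ∀ᶠ z in 𝓝 y, ContDiffAt ℝ ∞ s' (f z) ∧ s' (f z) ∈ D (f z) :=
    hf.self_of_nhds.continuousAt.eventually hs'
  -- The correction added to `x₀` makes `s` related to `s'`, and it vanishes at `y` by the choice of
  -- `x₀`.
  let s : V → Big V := fun z =>
    (x₀ + R ((A z).inverse ((s' (f z)).1 - fderiv ℝ f z x₀)), (s' (f z)).2.comp (fderiv ℝ f z))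
  have hrel : ∀ᶠ z in 𝓝 y, IsRelatedAt f s s' z := by
    filter_upwards [hinv] with z hz
    refine ⟨?_, rfl⟩
    have h1 : ∀ w, fderiv ℝ f z (R ((A z).inverse w)) = w := by
      obtain ⟨e, he⟩ := hz
      intro w
      change A z ((A z).inverse w) = w
      rw [← he]
      simp
    simp only [s]
    rw [map_add, h1]
    abel
  refine ⟨s, ?_, ?_, hrel⟩
  · filter_upwards [hf, hinv, hs'f, hrel] with z h1 h2 h3 h4
    have h5 : ContDiffAt ℝ ∞ (fun z => s' (f z)) z := h3.1.comp z h1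
    refine ⟨ContDiffAt.prodMk (contDiffAt_const.add (R.contDiff.contDiffAt.comp z ?_))
      (h5.snd.clm_comp (hdf z h1)), (s' (f z)).2, ?_, h4.2⟩
    · exact (h2.contDiffAt_map_inverse.comp z (hA z h1)).clm_apply
        (h5.fst.sub ((hdf z h1).clm_apply contDiffAt_const))
    · rw [h4.1]
      exact h3.2
  · simp only [s]
    rw [hx₀, sub_self, map_zero, map_zero, add_zero]

/-- Closure under the bracket is invariant under pullback by a submersion. -/
theorem isClosedAt_iff_of_eventually_eq_pull [FiniteDimensional ℝ V] [FiniteDimensional ℝ W]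
    {f : V → W} {D' : W → Submodule ℝ (Big W)}
    (hf : ∀ᶠ z in 𝓝 y, ContDiffAt ℝ ∞ f z) (hsurj : Function.Surjective (fderiv ℝ f y))
    (hD : HasLocalFrame k D y) (hD' : HasLocalFrame l D' (f y)) (hiso : IsIsotropicNear D y)
    (heq : ∀ᶠ z in 𝓝 y, D z = pull (fderiv ℝ f z) (D' (f z))) :
    IsClosedAt D y ↔ IsClosedAt D' (f y) := by
  have hf2 : ContDiffAt ℝ 2 f y := hf.self_of_nhds.of_le (by norm_cast)
  have hsec : ∀ s, IsLocalSection (fun z => pull (fderiv ℝ f z) (D' (f z))) y s →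
      IsLocalSection D y s := by
    intro s hs
    filter_upwards [hs, heq] with z hz hz'
    rwa [hz']
  -- For related pairs the brackets are related, so membership upstairs and downstairs agree.
  have key : ∀ {s t s' t'}, IsLocalSection D y s → IsLocalSection D y t →
      IsLocalSection D' (f y) s' → IsLocalSection D' (f y) t' →
      (∀ᶠ z in 𝓝 y, IsRelatedAt f s s' z) → (∀ᶠ z in 𝓝 y, IsRelatedAt f t t' z) →
      (courantVec s t y ∈ D y ↔ courantVec s' t' (f y) ∈ D' (f y)) := by
    intro s t s' t' hs ht hs' ht' h h'
    obtain ⟨h1, h2⟩ := IsRelatedAt.courantVec hf2 hs.differentiableAt hs'.differentiableAt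
      ht.differentiableAt ht'.differentiableAt h h'
    rw [heq.self_of_nhds, show courantVec s t y = ((courantVec s t y).1,
      (courantVec s' t' (f y)).2.comp (fderiv ℝ f y)) from Prod.ext rfl h2, mk_comp_mem_pull hsurj, h1]
  constructor
  · intro h s' t' hs' ht'
    obtain ⟨x, hx⟩ := hsurj (s' (f y)).1
    obtain ⟨x', hx'⟩ := hsurj (t' (f y)).1
    obtain ⟨s, hs, -, hss'⟩ := hs'.exists_lift hf hsurj hx
    obtain ⟨t, ht, -, htt'⟩ := ht'.exists_lift hf hsurj hx'
    exact (key (hsec s hs) (hsec t ht) hs' ht' hss' htt').1 (h s t (hsec s hs) (hsec t ht))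
  · intro h s t hs ht
    -- A section of `D` need not be related to any section downstairs. It is replaced by a lift with
    -- the same value at `y`, which suffices by `courantVec_mem_of_eq`.
    have hlift : ∀ s, IsLocalSection D y s → ∃ r r', IsLocalSection D y r ∧
        IsLocalSection D' (f y) r' ∧ r y = s y ∧ ∀ᶠ z in 𝓝 y, IsRelatedAt f r r' z := by
      intro s hs
      have hmem := hs.self_of_nhds.2
      rw [heq.self_of_nhds] at hmem
      obtain ⟨α, h1, h2⟩ := hmem
      obtain ⟨r', hr', hr'y⟩ := hD'.exists_section h1
      obtain ⟨r, hr, hry, hrr'⟩ := hr'.exists_lift hf hsurj (x₀ := (s y).1) (by rw [hr'y])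
      refine ⟨r, r', hsec r hr, hr', ?_, hrr'⟩
      rw [hry, hr'y]
      exact Prod.ext rfl h2.symm
    obtain ⟨r, r', hr, hr', hrs, hrr'⟩ := hlift s hs
    obtain ⟨q, q', hq, hq', hqt, hqq'⟩ := hlift t ht
    exact courantVec_mem_of_eq hD hiso hr hs hq ht hrs hqt
      ((key hr hq hr' hq' hrr' hqq').2 (h r' q' hr' hq'))

end Closed

/-! ### Differentials of charts, and smoothness of sections read in a chart. -/

section Charts

/-- The map `(x, α) ↦ (A x, α ∘ B)` between big spaces. -/
def bigMap {V W : Type*} [NormedAddCommGroup V] [NormedSpace ℝ V] [NormedAddCommGroup W]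
    [NormedSpace ℝ W] (A : V →L[ℝ] W) (B : W →L[ℝ] V) : Big V →ₗ[ℝ] Big W where
  toFun v := (A v.1, v.2.comp B)
  map_add' v w := by simp [ContinuousLinearMap.add_comp]
  map_smul' c v := by simp [ContinuousLinearMap.smul_comp]

/-- The model space of an `m`-dimensional manifold. -/
abbrev Model (m : ℕ) : Type := EuclideanSpace ℝ (Fin m)

variable {m : ℕ} {M : Type u} [TopologicalSpace M]
  [ChartedSpace (EuclideanSpace ℝ (Fin m)) M]

/-- The differential at `x` of the preferred chart at `x₀`. -/
def chartD (x₀ x : M) : Model m →L[ℝ] Model m :=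
  mfderiv (𝓡 m) 𝓘(ℝ, EuclideanSpace ℝ (Fin m)) (extChartAt (𝓡 m) x₀) x

/-- The differential of the inverse of the preferred chart at `x₀`, at the image of `x`. -/
def chartSymmD (x₀ x : M) : Model m →L[ℝ] Model m :=
  mfderiv 𝓘(ℝ, EuclideanSpace ℝ (Fin m)) (𝓡 m) (extChartAt (𝓡 m) x₀).symm (extChartAt (𝓡 m) x₀ x)

/-- The expression of an element of the big tangent bundle in the preferred chart at `x₀`. -/
def toChart (x₀ x : M) : Big (Model m) →ₗ[ℝ] Big (Model m) := bigMap (chartD x₀ x) (chartSymmD x₀ x)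

/-- The element of the big tangent bundle with a given expression in the preferred chart at
`x₀`. -/
def ofChart (x₀ x : M) : Big (Model m) →ₗ[ℝ] Big (Model m) := bigMap (chartSymmD x₀ x) (chartD x₀ x)

variable [IsManifold (𝓡 m) ∞ M]


variable {x₀ x : M}

theorem chartD_comp_chartSymmD (hx : x ∈ (extChartAt (𝓡 m) x₀).source) :
    (chartD x₀ x).comp (chartSymmD x₀ x) = ContinuousLinearMap.id ℝ (Model m) := by
  have h := mfderiv_extChartAt_comp_mfderivWithin_extChartAt_symm' (I := 𝓡 m) hx
  simp only [ModelWithCorners.range_eq_univ, mfderivWithin_univ] at h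
  exact h

theorem chartSymmD_comp_chartD (hx : x ∈ (extChartAt (𝓡 m) x₀).source) :
    (chartSymmD x₀ x).comp (chartD x₀ x) = ContinuousLinearMap.id ℝ (Model m) := by
  have h := mfderivWithin_extChartAt_symm_comp_mfderiv_extChartAt' (I := 𝓡 m) hx
  simp only [ModelWithCorners.range_eq_univ, mfderivWithin_univ] at h
  exact h

theorem chartD_self : chartD x x = ContinuousLinearMap.id ℝ (Model m) := by
  exact mfderiv_extChartAt_self

theorem chartSymmD_self : chartSymmD x x = ContinuousLinearMap.id ℝ (Model m) := by
  have h := chartSymmD_comp_chartD (mem_extChartAt_source (I := 𝓡 m) x)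
  rwa [chartD_self, ContinuousLinearMap.comp_id] at h

theorem toChart_ofChart (hx : x ∈ (extChartAt (𝓡 m) x₀).source) (v : Big (Model m)) :
    toChart x₀ x (ofChart x₀ x v) = v := by
  have h := chartD_comp_chartSymmD hx
  refine Prod.ext (congrArg (fun L : Model m →L[ℝ] Model m => L v.1) h) ?_
  change (v.2.comp (chartD x₀ x)).comp (chartSymmD x₀ x) = v.2
  rw [ContinuousLinearMap.comp_assoc, h, ContinuousLinearMap.comp_id]

theorem ofChart_toChart (hx : x ∈ (extChartAt (𝓡 m) x₀).source) (v : Big (Model m)) :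
    ofChart x₀ x (toChart x₀ x v) = v := by
  have h := chartSymmD_comp_chartD hx
  refine Prod.ext (congrArg (fun L : Model m →L[ℝ] Model m => L v.1) h) ?_
  change (v.2.comp (chartSymmD x₀ x)).comp (chartD x₀ x) = v.2
  rw [ContinuousLinearMap.comp_assoc, h, ContinuousLinearMap.comp_id]

/-- The section `σ` of the big tangent bundle is smooth at `x`. -/
def SmoothAt (σ : BigField m M) (x : M) : Prop :=
  ContMDiffAt (𝓡 m) (𝓡 m).tangent ∞
    (fun x => (TotalSpace.mk' (EuclideanSpace ℝ (Fin m)) x (σ x).1 : TangentBundle (𝓡 m) M)) x ∧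
  ContMDiffAt (𝓡 m) ((𝓡 m).prod 𝓘(ℝ, EuclideanSpace ℝ (Fin m) →L[ℝ] ℝ)) ∞
    (fun x => TotalSpace.mk' (EuclideanSpace ℝ (Fin m) →L[ℝ] ℝ)
      (E := fun y : M => TangentSpace (𝓡 m) y →L[ℝ] Bundle.Trivial M ℝ y) x (σ x).2) x

theorem smoothOn_iff {σ : BigField m M} {W : Set M} (hW : IsOpen W) :
    SmoothOn σ W ↔ ∀ x ∈ W, SmoothAt σ x := by
  constructor
  · rintro ⟨h1, h2⟩ x hx
    exact ⟨h1.contMDiffAt (hW.mem_nhds hx), h2.contMDiffAt (hW.mem_nhds hx)⟩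
  · intro h
    exact ⟨fun x hx => (h x hx).1.contMDiffWithinAt, fun x hx => (h x hx).2.contMDiffWithinAt⟩

/-- The trivialization of the tangent bundle at `x₀` is the differential of the preferred chart
there. -/
theorem contMDiffAt_vectorField_iff (X : (x : M) → TangentSpace (𝓡 m) x)
    (hx : x ∈ (extChartAt (𝓡 m) x₀).source) :
    ContMDiffAt (𝓡 m) (𝓡 m).tangent ∞
      (fun x => (TotalSpace.mk' (EuclideanSpace ℝ (Fin m)) x (X x) : TangentBundle (𝓡 m) M)) x ↔
    ContMDiffAt (𝓡 m) 𝓘(ℝ, Model m) ∞ (fun z => chartD x₀ z (X z)) x := by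
  rw [extChartAt_source] at hx
  rw [Trivialization.contMDiffAt_section_iff
    (trivializationAt (Model m) (TangentSpace (𝓡 m)) x₀) (by simpa using hx)]
  refine Filter.EventuallyEq.contMDiffAt_iff ?_
  filter_upwards [(chartAt (EuclideanSpace ℝ (Fin m)) x₀).open_source.mem_nhds hx] with z hz
  have h := TangentBundle.continuousLinearMapAt_trivializationAt (I := 𝓡 m) hz
  refine Eq.trans ?_ (congrArg (fun L : TangentSpace (𝓡 m) z →L[ℝ] Model m => L (X z)) h)
  rw [Trivialization.continuousLinearMapAt_apply, Trivialization.coe_linearMapAt_of_mem]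
  simpa using hz

/-- The trivialization of the cotangent bundle composes a covector with the differential of the
inverse chart. -/
theorem contMDiffAt_form_iff (α : (x : M) → (TangentSpace (𝓡 m) x →L[ℝ] ℝ))
    (hx : x ∈ (extChartAt (𝓡 m) x₀).source) :
    ContMDiffAt (𝓡 m) ((𝓡 m).prod 𝓘(ℝ, EuclideanSpace ℝ (Fin m) →L[ℝ] ℝ)) ∞
    (fun x => TotalSpace.mk' (EuclideanSpace ℝ (Fin m) →L[ℝ] ℝ)
      (E := fun y : M => TangentSpace (𝓡 m) y →L[ℝ] Bundle.Trivial M ℝ y) x (α x)) x ↔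
    ContMDiffAt (𝓡 m) 𝓘(ℝ, Model m →L[ℝ] ℝ) ∞
      (fun z => ContinuousLinearMap.comp (M₁ := Model m) (M₂ := Model m) (α z) (chartSymmD x₀ z)) x := by
  rw [extChartAt_source] at hx
  rw [Trivialization.contMDiffAt_section_iff
    (trivializationAt (Model m →L[ℝ] ℝ) (fun y : M => TangentSpace (𝓡 m) y →L[ℝ] Bundle.Trivial M ℝ y) x₀)
    (by simpa [hom_trivializationAt_baseSet] using hx)]
  refine Filter.EventuallyEq.contMDiffAt_iff ?_
  filter_upwards [(chartAt (EuclideanSpace ℝ (Fin m)) x₀).open_source.mem_nhds hx] with z hz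
  have h := TangentBundle.symmL_trivializationAt (I := 𝓡 m) hz
  simp only [ModelWithCorners.range_eq_univ, mfderivWithin_univ] at h
  rw [hom_trivializationAt_apply]
  refine Eq.trans ?_ (congrArg (fun L : Model m →L[ℝ] TangentSpace (𝓡 m) z => (α z).comp L) h)
  ext v
  simp [ContinuousLinearMap.inCoordinates]

end Charts

/-! ### Sections, subbundles and orthogonals in chart expression. -/

section ChartExpressions

variable {m : ℕ} {M : Type u} [TopologicalSpace M]
  [ChartedSpace (EuclideanSpace ℝ (Fin m)) M]

/-- An element of the big tangent bundle, seen in the big model space. -/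
def modelVec {x : M} (v : BigTangent m x) : Big (Model m) := v

/-- A section of the big tangent bundle, seen as a function with values in the big model space. -/
def modelField (σ : BigField m M) (x : M) : Big (Model m) := σ x

/-- A field of subspaces of the big tangent bundle, seen as a function with values in the subspaces
of the big model space. -/
def modelDist (E : BigDistribution m M) (x : M) : Submodule ℝ (Big (Model m)) := E x

/-- The expression of a section of the big tangent bundle in the preferred chart at `x₀`. -/
def chartRep (x₀ : M) (σ : BigField m M) (y : Model m) : Big (Model m) :=
  toChart x₀ ((extChartAt (𝓡 m) x₀).symm y) (modelField σ ((extChartAt (𝓡 m) x₀).symm y))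

/-- The section of the big tangent bundle with a given expression in the preferred chart at
`x₀`. -/
def fromChart (x₀ : M) (s : Model m → Big (Model m)) : BigField m M := fun z =>
  ofChart x₀ z (s (extChartAt (𝓡 m) x₀ z))

/-- The expression of a field of subspaces in the preferred chart at `x₀`. -/
def chartDist (x₀ : M) (E : BigDistribution m M) (y : Model m) : Submodule ℝ (Big (Model m)) :=
  Submodule.comap (ofChart x₀ ((extChartAt (𝓡 m) x₀).symm y)) (modelDist E ((extChartAt (𝓡 m) x₀).symm y))

theorem eventually_nhds_iff_chart {x₀ x : M} (hx : x ∈ (extChartAt (𝓡 m) x₀).source)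
    {P : M → Prop} :
    (∀ᶠ z in 𝓝 x, P z) ↔
      ∀ᶠ y in 𝓝 (extChartAt (𝓡 m) x₀ x), P ((extChartAt (𝓡 m) x₀).symm y) := by
  constructor
  · intro h
    have hc := continuousAt_extChartAt_symm' (I := 𝓡 m) hx
    rw [ContinuousAt, (extChartAt (𝓡 m) x₀).left_inv hx] at hc
    exact hc.eventually h
  · intro h
    filter_upwards [(continuousAt_extChartAt' (I := 𝓡 m) hx).eventually h,
      extChartAt_source_mem_nhds' (I := 𝓡 m) hx] with z hz hz'
    rwa [(extChartAt (𝓡 m) x₀).left_inv hz'] at hz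

theorem eventually_mem_chart_target (x : M) :
    ∀ᶠ y in 𝓝 (extChartAt (𝓡 m) x x), y ∈ (extChartAt (𝓡 m) x).target :=
  extChartAt_target_mem_nhds x

theorem neutralMetric_eq {x : M} (v w : BigTangent m x) :
    neutralMetric v w = (1 / 2) * pairing (Model m) (modelVec v) (modelVec w) := by
  exact congrArg (fun r : ℝ => 1 / 2 * r) (pairing_apply (V := Model m) v w).symm

theorem neutralMetric_eq_zero_iff {x : M} (v w : BigTangent m x) :
    neutralMetric v w = 0 ↔ pairing (Model m) (modelVec v) (modelVec w) = 0 := by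
  rw [neutralMetric_eq]
  simp

theorem modelDist_orth (E : BigDistribution m M) (x : M) :
    modelDist (orth E) x = (pairing (Model m)).orthogonal (modelDist E x) := by
  ext v
  rw [LinearMap.BilinForm.mem_orthogonal_iff]
  refine forall₂_congr fun w _ => (neutralMetric_eq_zero_iff (x := x) v w).trans ?_
  rw [pairing_comm]
  rfl

theorem mem_chartDist {x₀ x : M} (hx : x ∈ (extChartAt (𝓡 m) x₀).source) {E : BigDistribution m M}
    {w : Big (Model m)} :
    w ∈ chartDist x₀ E (extChartAt (𝓡 m) x₀ x) ↔ ofChart x₀ x w ∈ modelDist E x := by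
  unfold chartDist
  rw [(extChartAt (𝓡 m) x₀).left_inv hx, Submodule.mem_comap]

theorem chartRep_apply {x₀ x : M} (hx : x ∈ (extChartAt (𝓡 m) x₀).source) (σ : BigField m M) :
    chartRep x₀ σ (extChartAt (𝓡 m) x₀ x) = toChart x₀ x (modelField σ x) := by
  unfold chartRep
  rw [(extChartAt (𝓡 m) x₀).left_inv hx]

variable [IsManifold (𝓡 m) ∞ M] {x₀ x : M}

/-- `toChart` as a linear equivalence. -/
def toChartEquiv (hx : x ∈ (extChartAt (𝓡 m) x₀).source) : Big (Model m) ≃ₗ[ℝ] Big (Model m) :=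
  LinearEquiv.ofLinearMap (toChart x₀ x) (ofChart x₀ x)
    (LinearMap.ext (toChart_ofChart hx)) (LinearMap.ext (ofChart_toChart hx))

theorem chartRep_mem_chartDist {y : Model m} (hy : y ∈ (extChartAt (𝓡 m) x₀).target)
    {E : BigDistribution m M} {σ : BigField m M} :
    chartRep x₀ σ y ∈ chartDist x₀ E y ↔
      σ ((extChartAt (𝓡 m) x₀).symm y) ∈ E ((extChartAt (𝓡 m) x₀).symm y) := by
  unfold chartRep chartDist
  rw [Submodule.mem_comap, ofChart_toChart ((extChartAt (𝓡 m) x₀).map_target hy)]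
  rfl

theorem chartRep_fromChart {y : Model m} (hy : y ∈ (extChartAt (𝓡 m) x₀).target)
    (s : Model m → Big (Model m)) : chartRep x₀ (fromChart x₀ s) y = s y := by
  unfold chartRep
  change toChart _ _ (ofChart x₀ _ (s _)) = _
  rw [toChart_ofChart ((extChartAt (𝓡 m) x₀).map_target hy), (extChartAt (𝓡 m) x₀).right_inv hy]

/-- The point may differ from the centre `x₀`, so one fixed chart tests smoothness throughout a
neighbourhood. -/
theorem smoothAt_iff_contDiffAt (hx : x ∈ (extChartAt (𝓡 m) x₀).source) {σ : BigField m M} :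
    SmoothAt σ x ↔ ContDiffAt ℝ ∞ (chartRep x₀ σ) (extChartAt (𝓡 m) x₀ x) := by
  have h1 : SmoothAt σ x ↔
      ContMDiffAt (𝓡 m) 𝓘(ℝ, Big (Model m)) ∞ (fun z => toChart x₀ z (modelField σ z)) x := by
    unfold SmoothAt
    rw [contMDiffAt_vectorField_iff (fun z => (σ z).1) hx,
      contMDiffAt_form_iff (fun z => (σ z).2) hx]
    exact (contMDiffAt_prod_module_iff fun z => toChart x₀ z (modelField σ z)).symm
  rw [h1, ← contMDiffAt_iff_contDiffAt]
  have hx' := hx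
  rw [extChartAt_source] at hx'
  constructor
  · intro h
    have h2 : ContMDiffAt 𝓘(ℝ, Model m) (𝓡 m) ∞ (extChartAt (𝓡 m) x₀).symm
        (extChartAt (𝓡 m) x₀ x) :=
      (contMDiffOn_extChartAt_symm x₀).contMDiffAt
        ((isOpen_extChartAt_target x₀).mem_nhds ((extChartAt (𝓡 m) x₀).map_source hx))
    exact ContMDiffAt.comp_of_eq h h2 ((extChartAt (𝓡 m) x₀).left_inv hx)
  · intro h
    refine (h.comp x (contMDiffAt_extChartAt' hx')).congr_of_eventuallyEq ?_
    filter_upwards [extChartAt_source_mem_nhds' (I := 𝓡 m) hx] with z hz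
    exact (chartRep_apply hz σ).symm

/-- Vectors and covectors are transported by mutually inverse maps, which cancel in the pairing. -/
theorem pairing_ofChart (hx : x ∈ (extChartAt (𝓡 m) x₀).source) (v w : Big (Model m)) :
    pairing (Model m) (ofChart x₀ x v) (ofChart x₀ x w) = pairing (Model m) v w := by
  have h : ∀ u, chartD x₀ x (chartSymmD x₀ x u) = u := fun u =>
    congrArg (fun L : Model m →L[ℝ] Model m => L u) (chartD_comp_chartSymmD hx)
  rw [pairing_apply, pairing_apply]
  change v.2 (chartD x₀ x (chartSymmD x₀ x w.1)) + w.2 (chartD x₀ x (chartSymmD x₀ x v.1)) = _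
  rw [h, h]

theorem chartDist_orth {y : Model m} (hy : y ∈ (extChartAt (𝓡 m) x₀).target)
    (E : BigDistribution m M) :
    chartDist x₀ (orth E) y = (pairing (Model m)).orthogonal (chartDist x₀ E y) := by
  have hz := (extChartAt (𝓡 m) x₀).map_target hy
  unfold chartDist
  generalize (extChartAt (𝓡 m) x₀).symm y = z at hz
  ext v
  rw [Submodule.mem_comap, modelDist_orth, LinearMap.BilinForm.mem_orthogonal_iff,
    LinearMap.BilinForm.mem_orthogonal_iff]
  constructor
  · intro h w hw
    have := h _ hw
    rwa [pairing_ofChart hz] at this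
  · intro h u hu
    rw [← ofChart_toChart hz u] at hu ⊢
    rw [pairing_ofChart hz]
    exact h _ hu

theorem linearIndependent_and_span_iff {V W : Type*} [AddCommGroup V] [Module ℝ V] [AddCommGroup W]
    [Module ℝ W] {ι : Type*} (e : V ≃ₗ[ℝ] W) (v : ι → V) (S : Submodule ℝ V) :
    (LinearIndependent ℝ v ∧ Submodule.span ℝ (Set.range v) = S) ↔
      (LinearIndependent ℝ (fun i => e (v i)) ∧
        Submodule.span ℝ (Set.range fun i => e (v i)) = S.comap (e.symm : W →ₗ[ℝ] V)) := by
  refine and_congr (e.toLinearMap.linearIndependent_iff e.ker).symm ?_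
  have : Set.range (fun i => e (v i)) = (e : V →ₗ[ℝ] W) '' Set.range v := by
    rw [← Set.range_comp]; rfl
  rw [this, ← Submodule.map_span, ← Submodule.map_equiv_eq_comap_symm]
  exact (Submodule.map_injective_of_injective e.injective).eq_iff.symm

theorem isSubbundleOfRank_iff {k : ℕ} {E : BigDistribution m M} :
    IsSubbundleOfRank k E ↔ ∀ x, HasLocalFrame k (chartDist x E) (extChartAt (𝓡 m) x x) := by
  refine forall_congr' fun x => ?_
  have hx := mem_extChartAt_source (I := 𝓡 m) x
  have key : ∀ σ : Fin k → BigField m M, ∀ y ∈ (extChartAt (𝓡 m) x).target,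
      (((∀ i, SmoothAt (σ i) ((extChartAt (𝓡 m) x).symm y)) ∧
        LinearIndependent ℝ (fun i => σ i ((extChartAt (𝓡 m) x).symm y)) ∧
        Submodule.span ℝ (Set.range fun i => σ i ((extChartAt (𝓡 m) x).symm y)) =
          E ((extChartAt (𝓡 m) x).symm y)) ↔
      ((∀ i, ContDiffAt ℝ ∞ (chartRep x (σ i)) y) ∧
        LinearIndependent ℝ (fun i => chartRep x (σ i) y) ∧
        Submodule.span ℝ (Set.range fun i => chartRep x (σ i) y) = chartDist x E y)) := by
    intro σ y hy
    have hz := (extChartAt (𝓡 m) x).map_target hy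
    refine and_congr (forall_congr' fun i => ?_) ?_
    · rw [smoothAt_iff_contDiffAt hz, (extChartAt (𝓡 m) x).right_inv hy]
    · exact linearIndependent_and_span_iff (toChartEquiv hz) _ _
  constructor
  · rintro ⟨W, hW, hxW, σ, hσ, hσ'⟩
    refine ⟨fun i => chartRep x (σ i), ?_⟩
    have hW' := (eventually_nhds_iff_chart hx).1 (hW.mem_nhds hxW)
    filter_upwards [hW', eventually_mem_chart_target x] with y hy hy'
    exact (key σ y hy').1 ⟨fun i => (smoothOn_iff hW).1 (hσ i) _ hy, hσ' _ hy⟩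
  · rintro ⟨s, hs⟩
    have h : ∀ᶠ z in 𝓝 x, (∀ i, SmoothAt (fromChart x (s i)) z) ∧
        LinearIndependent ℝ (fun i => fromChart x (s i) z) ∧
        Submodule.span ℝ (Set.range fun i => fromChart x (s i) z) = E z := by
      rw [eventually_nhds_iff_chart hx]
      filter_upwards [hs.eventually_nhds, (eventually_mem_chart_target x).eventually_nhds]
        with y hy hy'
      refine (key (fun i => fromChart x (s i)) y hy'.self_of_nhds).2 ?_
      simp only [chartRep_fromChart hy'.self_of_nhds]
      refine ⟨fun i => ?_, hy.self_of_nhds.2⟩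
      refine (hy.self_of_nhds.1 i).congr_of_eventuallyEq ?_
      filter_upwards [hy'] with y' h' using chartRep_fromChart h' _
    obtain ⟨W, hWP, hW, hxW⟩ := eventually_nhds_iff.1 h
    exact ⟨W, hW, hxW, fun i => fromChart x (s i),
      fun i => (smoothOn_iff hW).2 fun z hz => (hWP z hz).1 i, fun z hz => (hWP z hz).2⟩

theorem IsSubbundleOfRank.orth {k : ℕ} {E : BigDistribution m M} (hE : IsSubbundleOfRank k E) :
    IsSubbundleOfRank (2 * m - k) (orth E) := by
  rw [isSubbundleOfRank_iff] at hE ⊢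
  intro x
  have h := (hE x).orthogonal
  rw [finrank_euclideanSpace_fin] at h
  refine h.congr ?_
  filter_upwards [eventually_mem_chart_target x] with y hy
  exact (chartDist_orth hy E).symm

end ChartExpressions

/-! ### The Courant bracket and integrability in charts. -/

section CourantInCharts

variable {m : ℕ} {M : Type u} [TopologicalSpace M]
  [ChartedSpace (EuclideanSpace ℝ (Fin m)) M] {x : M}

theorem chartSymmD_symm {y : Model m} (hy : y ∈ (extChartAt (𝓡 m) x).target) :
    chartSymmD x ((extChartAt (𝓡 m) x).symm y) =
      mfderiv 𝓘(ℝ, EuclideanSpace ℝ (Fin m)) (𝓡 m) (extChartAt (𝓡 m) x).symm y := by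
  unfold chartSymmD
  rw [(extChartAt (𝓡 m) x).right_inv hy]

theorem comp_mfderiv_chart_eventuallyEq (x : M) (σ : BigField m M) :
    (fun y => ContinuousLinearMap.comp (M₁ := Model m) (M₂ := Model m)
      (σ ((extChartAt (𝓡 m) x).symm y)).2
      (mfderiv 𝓘(ℝ, EuclideanSpace ℝ (Fin m)) (𝓡 m) (extChartAt (𝓡 m) x).symm y))
      =ᶠ[𝓝 (extChartAt (𝓡 m) x x)] fun y => (chartRep x σ y).2 := by
  filter_upwards [eventually_mem_chart_target x] with y hy
  exact congrArg (fun L : Model m →L[ℝ] Model m =>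
    ContinuousLinearMap.comp (M₁ := Model m) (M₂ := Model m)
      (σ ((extChartAt (𝓡 m) x).symm y)).2 L) (chartSymmD_symm hy).symm

variable [IsManifold (𝓡 m) ∞ M]

theorem mpullback_chart_eventuallyEq (x : M) (σ : BigField m M) :
    VectorField.mpullback 𝓘(ℝ, EuclideanSpace ℝ (Fin m)) (𝓡 m) (extChartAt (𝓡 m) x).symm
      (fun z => (σ z).1) =ᶠ[𝓝 (extChartAt (𝓡 m) x x)] fun y => (chartRep x σ y).1 := by
  filter_upwards [eventually_mem_chart_target x] with y hy
  have hz := (extChartAt (𝓡 m) x).map_target hy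
  have h1 := chartSymmD_comp_chartD hz
  have h2 := chartD_comp_chartSymmD hz
  have h3 : (chartSymmD x ((extChartAt (𝓡 m) x).symm y)).inverse =
      chartD x ((extChartAt (𝓡 m) x).symm y) := ContinuousLinearMap.inverse_eq h1 h2
  rw [chartSymmD_symm hy] at h3
  exact congrArg (fun L : Model m →L[ℝ] Model m => L (σ ((extChartAt (𝓡 m) x).symm y)).1) h3

theorem lieDerivVec_congr {V : Type*} [NormedAddCommGroup V] [NormedSpace ℝ V] {X X' : V → V}
    {β β' : V → (V →L[ℝ] ℝ)} {y : V} (hX : X =ᶠ[𝓝 y] X') (hβ : β =ᶠ[𝓝 y] β') :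
    lieDerivVec X β y = lieDerivVec X' β' y := by
  unfold lieDerivVec
  rw [hX.fderiv_eq, hβ.fderiv_eq, hX.self_of_nhds, hβ.self_of_nhds]

/-- The outer differential in `lieDeriv` disappears, being the identity at the centre of the
preferred chart. -/
theorem lieDeriv_eq (σ τ : BigField m M) (x : M) :
    lieDeriv (fun y => (σ y).1) (fun y => (τ y).2) x =
      lieDerivVec (fun y => (chartRep x σ y).1) (fun y => (chartRep x τ y).2)
        (extChartAt (𝓡 m) x x) := by
  rw [← lieDerivVec_congr (mpullback_chart_eventuallyEq x σ) (comp_mfderiv_chart_eventuallyEq x τ)]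
  unfold lieDeriv
  refine (congrArg (fun L : Model m →L[ℝ] Model m => ContinuousLinearMap.comp (M₁ := Model m)
    (M₂ := Model m) (lieDerivVec _ _ _) L) chartD_self).trans ?_
  exact ContinuousLinearMap.comp_id _

theorem mlieBracket_eq (σ τ : BigField m M) (x : M) :
    VectorField.mlieBracket (𝓡 m) (fun y => (σ y).1) (fun y => (τ y).1) x =
      VectorField.lieBracket ℝ (fun y => (chartRep x σ y).1) (fun y => (chartRep x τ y).1)
        (extChartAt (𝓡 m) x x) := by
  have h : ∀ {F G F' G' : Model m → Model m}, F =ᶠ[𝓝 (extChartAt (𝓡 m) x x)] F' →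
      G =ᶠ[𝓝 (extChartAt (𝓡 m) x x)] G' →
      (chartD x x).inverse (VectorField.lieBracketWithin ℝ F G univ (extChartAt (𝓡 m) x x)) =
        VectorField.lieBracket ℝ F' G' (extChartAt (𝓡 m) x x) := by
    intro F G F' G' hF hG
    rw [chartD_self, ContinuousLinearMap.inverse_id, VectorField.lieBracketWithin_univ,
      hF.lieBracket_vectorField_eq hG]
    rfl
  rw [← VectorField.mlieBracketWithin_univ, VectorField.mlieBracketWithin_apply]
  simp only [ModelWithCorners.range_eq_univ, Set.preimage_univ, Set.inter_univ,
    VectorField.mpullbackWithin_univ]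
  exact h (mpullback_chart_eventuallyEq x σ) (mpullback_chart_eventuallyEq x τ)

theorem apply_eq_chartRep_apply {x₀ z : M} (hz : z ∈ (extChartAt (𝓡 m) x₀).source)
    (σ τ : BigField m M) : (σ z).2 (τ z).1 =
      (chartRep x₀ σ (extChartAt (𝓡 m) x₀ z)).2 (chartRep x₀ τ (extChartAt (𝓡 m) x₀ z)).1 := by
  rw [chartRep_apply hz, chartRep_apply hz]
  exact congrArg (fun L : Model m →L[ℝ] Model m => (modelField σ z).2 (L (modelField τ z).1))
    (chartSymmD_comp_chartD hz).symm

theorem dFun_eq {f : M → ℝ} {g : Model m → ℝ} (hg : DifferentiableAt ℝ g (extChartAt (𝓡 m) x x))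
    (h : f =ᶠ[𝓝 x] fun z => g (extChartAt (𝓡 m) x z)) :
    dFun (m := m) f x = fderiv ℝ g (extChartAt (𝓡 m) x x) := by
  unfold dFun
  rw [h.mfderiv_eq]
  have h1 := mfderiv_comp (I := 𝓡 m) (I' := 𝓘(ℝ, Model m)) (I'' := 𝓘(ℝ, ℝ)) x (g := g)
    (f := extChartAt (𝓡 m) x) hg.mdifferentiableAt (mdifferentiableAt_extChartAt (mem_chart_source _ x))
  refine h1.trans ?_
  rw [mfderiv_eq_fderiv]
  exact (congrArg (fun L : Model m →L[ℝ] Model m => (fderiv ℝ g (extChartAt (𝓡 m) x x)).comp L)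
    chartD_self).trans (ContinuousLinearMap.comp_id _)

theorem SmoothAt.differentiableAt_chartRep {σ : BigField m M} (hσ : SmoothAt σ x) :
    DifferentiableAt ℝ (chartRep x σ) (extChartAt (𝓡 m) x x) :=
  ((smoothAt_iff_contDiffAt (mem_extChartAt_source x)).1 hσ).differentiableAt (by simp)

/-- The Courant bracket, computed in the preferred chart. -/
theorem modelField_courant {σ τ : BigField m M} (hσ : SmoothAt σ x) (hτ : SmoothAt τ x) :
    modelField (courant σ τ) x =
      courantVec (chartRep x σ) (chartRep x τ) (extChartAt (𝓡 m) x x) := by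
  have hs := hσ.differentiableAt_chartRep
  have ht := hτ.differentiableAt_chartRep
  have h1 : dFun (m := m) (fun y => (σ y).2 (τ y).1 - (τ y).2 (σ y).1) x =
      fderiv ℝ (fun y => (chartRep x σ y).2 (chartRep x τ y).1 -
        (chartRep x τ y).2 (chartRep x σ y).1) (extChartAt (𝓡 m) x x) := by
    refine dFun_eq ((hs.snd.clm_apply ht.fst).sub (ht.snd.clm_apply hs.fst)) ?_
    filter_upwards [extChartAt_source_mem_nhds (I := 𝓡 m) x] with z hz
    rw [apply_eq_chartRep_apply hz, apply_eq_chartRep_apply hz]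
  refine Prod.ext (mlieBracket_eq σ τ x) ?_
  exact congrArg₂ (fun a b : Model m →L[ℝ] ℝ => a + (1 / 2 : ℝ) • b)
    (congrArg₂ (fun a b : Model m →L[ℝ] ℝ => a - b) (lieDeriv_eq σ τ x) (lieDeriv_eq τ σ x)) h1

theorem courant_mem_iff {E : BigDistribution m M} {σ τ : BigField m M} (hσ : SmoothAt σ x)
    (hτ : SmoothAt τ x) : courant σ τ x ∈ E x ↔
      courantVec (chartRep x σ) (chartRep x τ) (extChartAt (𝓡 m) x x) ∈
        chartDist x E (extChartAt (𝓡 m) x x) := by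
  rw [mem_chartDist (mem_extChartAt_source x), ← modelField_courant hσ hτ]
  have : ofChart x x (modelField (courant σ τ) x) = modelField (courant σ τ) x := by
    refine Prod.ext ?_ ?_
    · change chartSymmD x x _ = _
      rw [chartSymmD_self]; rfl
    · change ContinuousLinearMap.comp (modelField (courant σ τ) x).2 (chartD x x) = _
      rw [chartD_self, ContinuousLinearMap.comp_id]
  rw [this]
  rfl

theorem IsSection.isLocalSection {E : BigDistribution m M} {σ : BigField m M} (hσ : IsSection E σ)
    (x : M) : IsLocalSection (chartDist x E) (extChartAt (𝓡 m) x x) (chartRep x σ) := by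
  filter_upwards [eventually_mem_chart_target x] with y hy
  have h := (smoothAt_iff_contDiffAt ((extChartAt (𝓡 m) x).map_target hy)).1
    ((smoothOn_iff isOpen_univ).1 hσ.1 _ (mem_univ _))
  rw [(extChartAt (𝓡 m) x).right_inv hy] at h
  exact ⟨h, (chartRep_mem_chartDist hy).2 (hσ.2 _)⟩

/-- A local section in a chart extends, near the centre of the chart, to a global section. -/
theorem IsLocalSection.exists_isSection [T2Space M] {E : BigDistribution m M}
    {s : Model m → Big (Model m)}
    (hs : IsLocalSection (chartDist x E) (extChartAt (𝓡 m) x x) s) :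
    ∃ σ : BigField m M, IsSection E σ ∧ chartRep x σ =ᶠ[𝓝 (extChartAt (𝓡 m) x x)] s := by
  have hx := mem_extChartAt_source (I := 𝓡 m) x
  have hloc : ∀ᶠ z in 𝓝 x, SmoothAt (fromChart x s) z ∧ fromChart x s z ∈ E z := by
    rw [eventually_nhds_iff_chart hx]
    filter_upwards [hs.eventually_nhds, (eventually_mem_chart_target x).eventually_nhds] with y hy hy'
    have hz := (extChartAt (𝓡 m) x).map_target hy'.self_of_nhds
    rw [smoothAt_iff_contDiffAt hz, (extChartAt (𝓡 m) x).right_inv hy'.self_of_nhds,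
      ← chartRep_mem_chartDist hy'.self_of_nhds, chartRep_fromChart hy'.self_of_nhds]
    refine ⟨hy.self_of_nhds.1.congr_of_eventuallyEq ?_, hy.self_of_nhds.2⟩
    filter_upwards [hy'] with y' h' using chartRep_fromChart h' _
  obtain ⟨W, hWP, hW, hxW⟩ := eventually_nhds_iff.1 hloc
  -- The bump function equals one near `x`, so the germ is unchanged, and its support lies in `W`,
  -- so extension by zero is smooth. Its global smoothness rests on `M` being Hausdorff.
  obtain ⟨ρ, -, hρ⟩ := (SmoothBumpFunction.nhds_basis_tsupport (I := 𝓡 m) x).mem_iff.1 (hW.mem_nhds hxW)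
  have hsm := (smoothOn_iff hW).2 fun z hz => (hWP z hz).1
  refine ⟨fun z => ρ z • fromChart x s z, ⟨⟨?_, ?_⟩, fun z => ?_⟩, ?_⟩
  · rw [contMDiffOn_univ]
    exact ContMDiffOn.smul_section_of_tsupport ρ.contMDiff.contMDiffOn hW hρ hsm.1
  · rw [contMDiffOn_univ]
    exact ContMDiffOn.smul_section_of_tsupport ρ.contMDiff.contMDiffOn hW hρ hsm.2
  · change ρ z • fromChart x s z ∈ E z
    by_cases hz : z ∈ W
    · exact (E z).smul_mem _ (hWP z hz).2
    · rw [image_eq_zero_of_notMem_tsupport fun h => hz (hρ h), zero_smul]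
      exact (E z).zero_mem
  · have h1 := (eventually_nhds_iff_chart hx).1 ρ.eventuallyEq_one
    filter_upwards [h1, eventually_mem_chart_target x] with y hy hy'
    rw [← chartRep_fromChart hy' s]
    refine congrArg (toChart x ((extChartAt (𝓡 m) x).symm y)) ?_
    change ρ ((extChartAt (𝓡 m) x).symm y) • fromChart x s ((extChartAt (𝓡 m) x).symm y) = _
    rw [hy, Pi.one_apply, one_smul]
    rfl

/-- The bracket depends only on germs, and each germ of a section is that of a global one. -/
theorem isIntegrable_iff [T2Space M] {E : BigDistribution m M} :
    IsIntegrable E ↔ ∀ x, IsClosedAt (chartDist x E) (extChartAt (𝓡 m) x x) := by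
  have hsm : ∀ {σ : BigField m M}, IsSection E σ → ∀ x, SmoothAt σ x := fun hσ x =>
    (smoothOn_iff isOpen_univ).1 hσ.1 x (mem_univ x)
  constructor
  · intro h x s t hs ht
    obtain ⟨σ, hσ, hσs⟩ := hs.exists_isSection
    obtain ⟨τ, hτ, hτt⟩ := ht.exists_isSection
    rw [← courantVec_congr hσs hτt, ← courant_mem_iff (hsm hσ x) (hsm hτ x)]
    exact h σ τ hσ hτ x
  · intro h σ τ hσ hτ x
    rw [courant_mem_iff (hsm hσ x) (hsm hτ x)]
    exact h x _ _ (hσ.isLocalSection x) (hτ.isLocalSection x)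

end CourantInCharts

/-! ### Pullback of subbundles by a smooth map, in charts. -/

section Pullback

/-- Pullback is compatible with isomorphisms of source and target; the isomorphisms used later are
the differentials of charts. -/
theorem comap_bigMap_pull {V W V' W' : Type*} [NormedAddCommGroup V] [NormedSpace ℝ V]
    [NormedAddCommGroup W] [NormedSpace ℝ W] [NormedAddCommGroup V'] [NormedSpace ℝ V']
    [NormedAddCommGroup W'] [NormedSpace ℝ W'] (A : V →L[ℝ] W) {C : V →L[ℝ] V'} {C' : V' →L[ℝ] V}
    {P : W →L[ℝ] W'} {P' : W' →L[ℝ] W} (hC : C.comp C' = ContinuousLinearMap.id ℝ V')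
    (hC' : C'.comp C = ContinuousLinearMap.id ℝ V) (hP' : P'.comp P = ContinuousLinearMap.id ℝ W)
    (S : Submodule ℝ (Big W)) :
    (pull A S).comap (bigMap C' C) = pull ((P.comp A).comp C') (S.comap (bigMap P' P)) := by
  have hPP : ∀ w, P' (P w) = w := fun w => congrArg (fun L : W →L[ℝ] W => L w) hP'
  ext v
  rw [Submodule.mem_comap, mem_pull, mem_pull]
  constructor
  · rintro ⟨α, h1, h2⟩
    refine ⟨α.comp P', ?_, ?_⟩
    · rw [Submodule.mem_comap]
      change (P' (P (A (C' v.1))), (α.comp P').comp P) ∈ S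
      rwa [hPP, ContinuousLinearMap.comp_assoc, hP', ContinuousLinearMap.comp_id]
    · have h3 : v.2.comp C = α.comp A := h2
      calc v.2 = (v.2.comp C).comp C' := by
            rw [ContinuousLinearMap.comp_assoc, hC, ContinuousLinearMap.comp_id]
        _ = (α.comp P').comp ((P.comp A).comp C') := by
            rw [h3]
            ext u
            simp [hPP]
  · rintro ⟨β, h1, h2⟩
    refine ⟨β.comp P, ?_, ?_⟩
    · rw [Submodule.mem_comap] at h1
      change (P' (P (A (C' v.1))), β.comp P) ∈ S at h1
      rwa [hPP] at h1
    · change v.2.comp C = _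
      rw [h2]
      ext u
      simp [show C' (C u) = u from congrArg (fun L : V →L[ℝ] V => L u) hC']

variable {m n : ℕ} {M N : Type u} [TopologicalSpace M]
  [ChartedSpace (EuclideanSpace ℝ (Fin m)) M] [TopologicalSpace N]
  [ChartedSpace (EuclideanSpace ℝ (Fin n)) N]

/-- The differential of a map between manifolds, as a map between the model spaces. -/
def modelD (m n : ℕ) {M N : Type u} [TopologicalSpace M]
    [ChartedSpace (EuclideanSpace ℝ (Fin m)) M] [TopologicalSpace N]
    [ChartedSpace (EuclideanSpace ℝ (Fin n)) N] (f : M → N) (x : M) : Model m →L[ℝ] Model n := mfderiv (𝓡 m) (𝓡 n) f x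

/-- The expression of a map in the preferred charts at `x` and `f x`. -/
def chartMap (m n : ℕ) {M N : Type u} [TopologicalSpace M]
    [ChartedSpace (EuclideanSpace ℝ (Fin m)) M] [TopologicalSpace N]
    [ChartedSpace (EuclideanSpace ℝ (Fin n)) N] (f : M → N) (x : M) (y : Model m) : Model n :=
  extChartAt (𝓡 n) (f x) (f ((extChartAt (𝓡 m) x).symm y))

theorem chartMap_self (f : M → N) (x : M) :
    chartMap m n f x (extChartAt (𝓡 m) x x) = extChartAt (𝓡 n) (f x) (f x) := by
  unfold chartMap
  rw [extChartAt_to_inv]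

theorem isotropic_iff_modelDist_le {x : M} {E : BigDistribution m M} :
    (∀ v ∈ E x, ∀ w ∈ E x, neutralMetric v w = 0) ↔
      modelDist E x ≤ (pairing (Model m)).orthogonal (modelDist E x) := by
  rw [← modelDist_orth]
  rfl

variable [IsManifold (𝓡 m) ∞ M] [IsManifold (𝓡 n) ∞ N] {f : M → N} {x : M} {U : Set M}

theorem eventually_contDiffAt_chartMap (hU : IsOpen U) (hf : ContMDiffOn (𝓡 m) (𝓡 n) ∞ f U)
    (hx : x ∈ U) :
    ∀ᶠ y in 𝓝 (extChartAt (𝓡 m) x x), ContDiffAt ℝ ∞ (chartMap m n f x) y ∧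
      fderiv ℝ (chartMap m n f x) y = ((chartD (f x) (f ((extChartAt (𝓡 m) x).symm y))).comp
        (modelD m n f ((extChartAt (𝓡 m) x).symm y))).comp
        (chartSymmD x ((extChartAt (𝓡 m) x).symm y)) := by
  have h1 := (eventually_nhds_iff_chart (mem_extChartAt_source (I := 𝓡 m) x)).1 (hU.mem_nhds hx)
  have h2 := (eventually_nhds_iff_chart (mem_extChartAt_source (I := 𝓡 m) x)).1
    ((hf.contMDiffAt (hU.mem_nhds hx)).continuousAt.eventually
      (extChartAt_source_mem_nhds (I := 𝓡 n) (f x)))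
  filter_upwards [h1, h2, eventually_mem_chart_target x] with y hy1 hy2 hy3
  have hy2' := hy2
  rw [extChartAt_source] at hy2'
  have c1 : ContMDiffAt 𝓘(ℝ, Model m) (𝓡 m) ∞ (extChartAt (𝓡 m) x).symm y :=
    (contMDiffOn_extChartAt_symm x).contMDiffAt ((isOpen_extChartAt_target x).mem_nhds hy3)
  have c2 : ContMDiffAt (𝓡 m) (𝓡 n) ∞ f ((extChartAt (𝓡 m) x).symm y) :=
    hf.contMDiffAt (hU.mem_nhds hy1)
  have c3 : ContMDiffAt (𝓡 n) 𝓘(ℝ, Model n) ∞ (extChartAt (𝓡 n) (f x))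
      (f ((extChartAt (𝓡 m) x).symm y)) := contMDiffAt_extChartAt' hy2'
  have c12 := c2.comp y c1
  refine ⟨(c3.comp y c12).contDiffAt, ?_⟩
  rw [chartSymmD_symm hy3, ← mfderiv_eq_fderiv]
  refine (mfderiv_comp y (c3.mdifferentiableAt (by simp)) (c12.mdifferentiableAt (by simp))).trans ?_
  rw [mfderiv_comp y (c2.mdifferentiableAt (by simp)) (c1.mdifferentiableAt (by simp))]
  rfl

theorem eventually_chartDist_eq_pull (hU : IsOpen U) (hf : ContMDiffOn (𝓡 m) (𝓡 n) ∞ f U)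
    (hx : x ∈ U) {E : BigDistribution m M} {D : BigDistribution n N}
    (hE : ∀ z ∈ U, E z = bigPullback f D z) :
    ∀ᶠ y in 𝓝 (extChartAt (𝓡 m) x x), chartDist x E y =
      pull (fderiv ℝ (chartMap m n f x) y) (chartDist (f x) D (chartMap m n f x y)) := by
  have h1 := (eventually_nhds_iff_chart (mem_extChartAt_source (I := 𝓡 m) x)).1 (hU.mem_nhds hx)
  have h2 := (eventually_nhds_iff_chart (mem_extChartAt_source (I := 𝓡 m) x)).1
    ((hf.contMDiffAt (hU.mem_nhds hx)).continuousAt.eventually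
      (extChartAt_source_mem_nhds (I := 𝓡 n) (f x)))
  filter_upwards [h1, h2, eventually_mem_chart_target x, eventually_contDiffAt_chartMap hU hf hx]
    with y hy1 hy2 hy3 hy4
  have hz := (extChartAt (𝓡 m) x).map_target hy3
  have h3 : modelDist E ((extChartAt (𝓡 m) x).symm y) = pull (modelD m n f ((extChartAt (𝓡 m) x).symm y))
      (modelDist D (f ((extChartAt (𝓡 m) x).symm y))) := hE _ hy1
  have h4 : chartDist (f x) D (chartMap m n f x y) =
      (modelDist D (f ((extChartAt (𝓡 m) x).symm y))).comap
        (ofChart (f x) (f ((extChartAt (𝓡 m) x).symm y))) := by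
    ext w
    exact mem_chartDist hy2
  rw [hy4.2, h4]
  unfold chartDist
  rw [h3]
  exact comap_bigMap_pull _ (chartD_comp_chartSymmD hz) (chartSymmD_comp_chartD hz)
    (chartSymmD_comp_chartD hy2) _

theorem fderiv_chartMap_self (hU : IsOpen U) (hf : ContMDiffOn (𝓡 m) (𝓡 n) ∞ f U) (hx : x ∈ U) :
    fderiv ℝ (chartMap m n f x) (extChartAt (𝓡 m) x x) = modelD m n f x := by
  rw [(eventually_contDiffAt_chartMap hU hf hx).self_of_nhds.2, extChartAt_to_inv, chartD_self,
    chartSymmD_self, ContinuousLinearMap.comp_id, ContinuousLinearMap.id_comp]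

theorem IsSubbundleOfRank.finrank_eq {k : ℕ} {E : BigDistribution m M} (hE : IsSubbundleOfRank k E)
    (x : M) : finrank ℝ (modelDist E x) = k := by
  obtain ⟨W, -, hxW, s, -, hs⟩ := hE x
  obtain ⟨h1, h2⟩ := hs x hxW
  have h3 : Submodule.span ℝ (Set.range fun i => modelField (s i) x) = modelDist E x := h2
  have h4 : LinearIndependent ℝ (fun i => modelField (s i) x) := h1
  rw [← h3, finrank_span_eq_card h4, Fintype.card_fin]

theorem isIsotropicNear_chartDist {E : BigDistribution m M}
    (hE : ∀ x, ∀ v ∈ E x, ∀ w ∈ E x, neutralMetric v w = 0) (x : M) :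
    IsIsotropicNear (chartDist x E) (extChartAt (𝓡 m) x x) := by
  filter_upwards [eventually_mem_chart_target x] with y hy v hv w hw
  rw [← pairing_ofChart ((extChartAt (𝓡 m) x).map_target hy)]
  exact (neutralMetric_eq_zero_iff _ _).1 (hE _ _ hv _ hw)

end Pullback

/-! ### Projected bundles on local spaces of leaves. -/

section Projection

variable {m p : ℕ} {M : Type u} [TopologicalSpace M]
  [ChartedSpace (EuclideanSpace ℝ (Fin m)) M] {F : Foliation m p M}
  {L : LocalLeafSpace F} {E : BigDistribution m M} {D : BigDistribution (m - p) L.Q}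

theorem LocalLeafSpace.modelD_surjective (L : LocalLeafSpace F) {x : M} (hx : x ∈ L.U) :
    Function.Surjective (modelD m (m - p) L.proj x) :=
  L.submersion_proj x hx

theorem IsProjectedBundle.modelDist_eq (h : IsProjectedBundle L E D) {x : M} (hx : x ∈ L.U) :
    modelDist E x = pull (modelD m (m - p) L.proj x) (modelDist D (L.proj x)) :=
  h.2 x hx

/-- The projected bundle on a local space of leaves is unique. -/
theorem IsProjectedBundle.unique {D' : BigDistribution (m - p) L.Q} (h : IsProjectedBundle L E D)
    (h' : IsProjectedBundle L E D') : D' = D := by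
  funext q
  obtain ⟨x, hx, rfl⟩ := L.surj_proj q
  have h1 := (h'.modelDist_eq hx).symm.trans (h.modelDist_eq hx)
  exact pull_injective (L.modelD_surjective hx) h1

/-- The orthogonal of the projected bundle is a projected bundle of the orthogonal. -/
theorem IsProjectedBundle.orth (h : IsProjectedBundle L E D) :
    IsProjectedBundle L (orth E) (orth D) := by
  obtain ⟨k, hk⟩ := h.1
  refine ⟨⟨_, hk.orth⟩, fun x hx => ?_⟩
  have h1 : modelDist (BigIso.orth E) x =
      pull (modelD m (m - p) L.proj x) (modelDist (BigIso.orth D) (L.proj x)) := by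
    rw [modelDist_orth, modelDist_orth, h.modelDist_eq hx,
      orthogonal_pull (L.modelD_surjective hx)]
  exact h1

theorem IsProjectedBundle.isotropic (h : IsProjectedBundle L E D)
    (hE : ∀ x, ∀ v ∈ E x, ∀ w ∈ E x, neutralMetric v w = 0) (q : L.Q) :
    ∀ v ∈ D q, ∀ w ∈ D q, neutralMetric v w = 0 := by
  obtain ⟨x, hx, rfl⟩ := L.surj_proj q
  refine isotropic_iff_modelDist_le.2 (isotropic_of_pull (L.modelD_surjective hx) ?_)
  rw [← h.modelDist_eq hx]
  exact isotropic_iff_modelDist_le.1 (hE x)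

theorem IsProjectedBundle.isBigIsotropic (h : IsProjectedBundle L E D)
    (hE : ∀ x, ∀ v ∈ E x, ∀ w ∈ E x, neutralMetric v w = 0) : IsBigIsotropic D := by
  refine ⟨?_, h.isotropic hE⟩
  obtain ⟨k, hk⟩ := h.1
  -- On an empty quotient every number is a rank, so `k` may exceed the bound and is replaced by
  -- `0`. Otherwise isotropy at one point bounds `k`.
  rcases isEmpty_or_nonempty L.Q with hQ | ⟨⟨q⟩⟩
  · exact ⟨0, Nat.zero_le _, fun q => hQ.elim q⟩
  · refine ⟨k, ?_, hk⟩
    have := finrank_le_of_isotropic (isotropic_iff_modelDist_le.1 (h.isotropic hE q))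
    rwa [hk.finrank_eq, finrank_euclideanSpace_fin] at this

variable [IsManifold (𝓡 m) ∞ M]

theorem IsProjectedBundle.isClosedAt_iff (h : IsProjectedBundle L E D) (hE : IsBigIsotropic E)
    {x : M} (hx : x ∈ L.U) :
    IsClosedAt (chartDist x E) (extChartAt (𝓡 m) x x) ↔
      IsClosedAt (chartDist (L.proj x) D) (extChartAt (𝓡 (m - p)) (L.proj x) (L.proj x)) := by
  obtain ⟨⟨k, -, hk⟩, hiso⟩ := hE
  obtain ⟨l, hl⟩ := h.1
  rw [← chartMap_self (m := m) (n := m - p) L.proj x]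
  refine isClosedAt_iff_of_eventually_eq_pull (k := k) (l := l)
    ((eventually_contDiffAt_chartMap L.isOpen_U L.smooth_proj hx).mono fun _ h => h.1) ?_
    (isSubbundleOfRank_iff.1 hk x) ?_ (isIsotropicNear_chartDist hiso x)
    (eventually_chartDist_eq_pull L.isOpen_U L.smooth_proj hx h.2)
  · rw [fderiv_chartMap_self L.isOpen_U L.smooth_proj hx]
    exact L.modelD_surjective hx
  · rw [chartMap_self]
    exact isSubbundleOfRank_iff.1 hl _

/-- Closure is compared point by point: descent uses that each point of a quotient is the image of
some `x`, ascent that each `x` lies in a member of the family. -/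
theorem isIntegrable_iff_of_cover [T2Space M] (hE : IsBigIsotropic E)
    (S : Set (LocalProjection F E)) (hS : ∀ x : M, ∃ P ∈ S, x ∈ P.L.U) :
    IsIntegrable E ↔ ∀ P ∈ S, IsIntegrable P.D := by
  rw [isIntegrable_iff]
  constructor
  · intro h P _
    rw [isIntegrable_iff]
    intro q
    obtain ⟨x, hx, rfl⟩ := P.L.surj_proj q
    exact (P.isProjected.isClosedAt_iff hE hx).1 (h x)
  · intro h x
    obtain ⟨P, hP, hx⟩ := hS x
    exact (P.isProjected.isClosedAt_iff hE hx).2 (isIntegrable_iff.1 (h P hP) _)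

end Projection

end BigIso

end

theorem proposition5p5 {m p : ℕ} {M : Type u} [TopologicalSpace M] [T2Space M]
    [ChartedSpace (EuclideanSpace ℝ (Fin m)) M] [IsManifold (𝓡 m) ∞ M]
    (F : BigIso.Foliation m p M) (E : BigIso.BigDistribution m M)
    (hE : BigIso.IsBigIsotropic E) (hproj : BigIso.IsProjectable F E) :
    -- the orthogonal bundle is projectable
    BigIso.IsProjectable F (BigIso.orth E) ∧
    -- every local projected bundle is big-isotropic, and its orthogonal bundle is the (one and
    -- only) projected bundle of the orthogonal of `E` on the same local space of leaves
    (∀ P : BigIso.LocalProjection F E,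
      BigIso.IsBigIsotropic P.D ∧
      ∀ D' : BigIso.BigDistribution (m - p) P.L.Q,
        BigIso.IsProjectedBundle P.L (BigIso.orth E) D' ↔ D' = BigIso.orth P.D) ∧
    -- `E` is integrable iff all the local projected bundles are integrable
    (BigIso.IsIntegrable E ↔ ∀ P : BigIso.LocalProjection F E, BigIso.IsIntegrable P.D) ∧
    -- it is enough to test any family of local projected bundles that covers `M`
    (∀ S : Set (BigIso.LocalProjection F E), (∀ x : M, ∃ P ∈ S, x ∈ P.L.U) →
      (BigIso.IsIntegrable E ↔ ∀ P ∈ S, BigIso.IsIntegrable P.D)) := by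
  have hiso := hE.2
  obtain ⟨k, hk⟩ := hproj.1
  have hcover := BigIso.isIntegrable_iff_of_cover (F := F) hE
  refine ⟨⟨⟨_, hk.orth⟩, fun x => ?_⟩, fun P => ⟨P.isProjected.isBigIsotropic hiso, fun D' => ?_⟩,
    ?_, hcover⟩
  · obtain ⟨L, hx, D, hD⟩ := hproj.2 x
    exact ⟨L, hx, _, hD.orth⟩
  · exact ⟨fun h => P.isProjected.orth.unique h, fun h => h ▸ P.isProjected.orth⟩
  · refine (hcover Set.univ fun x => ?_).trans (by simp)
    obtain ⟨L, hx, D, hD⟩ := hproj.2 x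
    exact ⟨⟨L, D, hD⟩, Set.mem_univ _, hx⟩
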